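/- Let $\Omega=\{(x,y,z)\in\mathbb R^3: x^2+y^2<1,\ 0<z<1\}$ and let $B$ be the open unit disc centred at the origin of the $xy$-plane. Let $\varphi\in C^2(\overline B)$ be radial with profile $\phi$, that is $\varphi(x,y)=\phi(\sqrt{x^2+y^2})$, with $\Delta\varphi\neq0$ at some point of $B$ and $\phi(1)=\phi'(1)=\int_0^1r^2\phi'(r)\,dr=0$. Let $\psi\in C^0([0,1])$ with $\int_0^1\psi(z)\,dz=0$ and $\int_0^1z\,\psi(z)\,dz>0$. Put $$\mathbf f(x,y,z)=(\varphi_x(x,y),\varphi_y(x,y),\psi(z)),\qquad \mathcal L(\mathbf v)=\int_\Omega\mathbf f\cdot\mathbf v\,d\mathbf x,\qquad \mathcal S^0_{\mathcal L}=\{\mathbf R\in SO(3):\ \mathcal L((\mathbf R-\mathbf I)\mathbf x)=0\}.$$ Let $\mathcal W:\mathbb R^{3\times3}\to[0,+\infty]$ be finite and of class $C^2$ near the identity $\mathbf I$, and suppose that $\mathcal Q(\mathbf F):=\tfrac12D^2\mathcal W(\mathbf I)[\mathbf F,\mathbf F]=4|\mathbf F|^2$ for every symmetric $\mathbf F\in\mathbb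 R^{3\times3}$, where $|\cdot|$ is the Euclidean (Frobenius) norm. For $\mathbf u\in H^1(\Omega,\mathbb R^3)$ let $\mathbb E(\mathbf u)=\tfrac12(\nabla\mathbf u+\nabla\mathbf u^T)$ and $$\mathcal G(\mathbf u)=\int_\Omega\mathcal Q(\mathbb E(\mathbf u))\,d\mathbf x-\mathcal L(\mathbf u)-\max_{\mathbf R\in\mathcal S^0_{\mathcal L}}\mathcal L((\mathbf R-\mathbf I)\mathbf u).$$ A field $\mathbf v\in H^1(\Omega,\mathbb R^3)$ is called an infinitesimal rigid displacement if $\mathbb E(\mathbf v)=0$ a.e. in $\Omega$. (i) Every minimizer $\mathbf u$ of $\mathcal G$ over $H^1(\Omega,\mathbb R^3)$ has the form $\mathbf u=\mathbf w^0+\mathbf w$ a.e. in $\Omega$, where $\mathbf w^0$ is an infinitesimal rigid displacement and $\mathbf w=(w_1,w_2,w_3)\in H^1(\Omega,\mathbb R^3)$ is such that $w_1,w_2$ do not depend on $z$ and $w_3$ depends only on $z$. (ii) Minimizers of $\mathcal G$ over $H^1(\Omega,\mathbb R^3)$ are not unique up to infinitesimal rigid displacements: there are two minimizers whose difference is not an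 infinitesimal rigid displacement. -/

import Mathlib

open MeasureTheory Set Filter Topology
open scoped Matrix ENNReal ContDiff

noncomputable section

namespace CylinderGap

/-- Points and vectors of `ℝ³`, with Lebesgue measure `volume`. -/
abbrev V3 : Type := Fin 3 → ℝ

/-- `3 × 3` real matrices. -/
abbrev M3 : Type := Matrix (Fin 3) (Fin 3) ℝ

/-- The cylinder `x² + y² < 1`, `0 < z < 1`. -/
def cylinder : Set V3 := {x | x 0 ^ 2 + x 1 ^ 2 < 1 ∧ 0 < x 2 ∧ x 2 < 1}

/-- The open unit disc `B` of the `xy` plane. -/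
def disc : Set (ℝ × ℝ) := {p | p.1 ^ 2 + p.2 ^ 2 < 1}

/-- The closed unit disc of the `xy` plane. -/
def closedDisc : Set (ℝ × ℝ) := {p | p.1 ^ 2 + p.2 ^ 2 ≤ 1}

/-! ### Sobolev fields and infinitesimal strain -/

/-- `g` is the weak `j`-th partial derivative of `v` in the open set `Ω`. -/
def IsWeakPartial (Ω : Set V3) (j : Fin 3) (v g : V3 → ℝ) : Prop :=
  ∀ ζ : V3 → ℝ, ContDiff ℝ ∞ ζ → HasCompactSupport ζ → tsupport ζ ⊆ Ω →
    ∫ x in Ω, v x * fderiv ℝ ζ x (Pi.single j 1) = -∫ x in Ω, g x * ζ x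

/-- `A` is a square-integrable weak gradient of the square-integrable field `u` in `Ω`, with
`A x i j = ∂ⱼ uᵢ (x)`. -/
structure IsWeakGradient (Ω : Set V3) (u : V3 → V3) (A : V3 → M3) : Prop where
  memLp : ∀ i, MemLp (fun x => u x i) 2 (volume.restrict Ω)
  grad_memLp : ∀ i j, MemLp (fun x => A x i j) 2 (volume.restrict Ω)
  isWeakPartial : ∀ i j, IsWeakPartial Ω j (fun x => u x i) (fun x => A x i j)

/-- `u` represents an element of `H¹(Ω, ℝ³)`. -/
def MemH1 (Ω : Set V3) (u : V3 → V3) : Prop := ∃ A, IsWeakGradient Ω u A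

open Classical in
/-- The weak gradient of `u ∈ H¹(Ω, ℝ³)` (unique up to null sets when `Ω` is open). -/
def weakGrad (Ω : Set V3) (u : V3 → V3) : V3 → M3 :=
  if h : MemH1 Ω u then h.choose else 0

/-- The infinitesimal strain `𝔼(u) = sym ∇u`. -/
def strain (Ω : Set V3) (u : V3 → V3) (x : V3) : M3 :=
  (1 / 2 : ℝ) • (weakGrad Ω u x + (weakGrad Ω u x)ᵀ)

/-- Infinitesimal rigid displacements: the fields `v ∈ H¹(Ω, ℝ³)` with `𝔼(v) = 0`. -/
def IsInfinitesimalRigid (Ω : Set V3) (v : V3 → V3) : Prop :=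
  MemH1 Ω v ∧ ∀ᵐ x ∂volume.restrict Ω, strain Ω v x = 0

/-! ### The strain energy density -/

section Density

attribute [local instance] Matrix.frobeniusNormedAddCommGroup Matrix.frobeniusNormedSpace

/-- The quadratic form `𝒬(F) = ½ D²𝒲(I)[F, F]` of a density `𝒲 : ℝ^{3×3} → [0, +∞]`. -/
def quadForm (W : M3 → ℝ≥0∞) (F : M3) : ℝ :=
  (1 / 2 : ℝ) * iteratedFDeriv ℝ 2 (fun G : M3 => (W G).toReal) 1 ![F, F]

/-- `𝒲` is finite and `C²` near the identity, and `½ D²𝒲(I)[F, F] = 4 |F|²` for symmetric `F`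
(Euclidean norm). A frame indifferent `𝒲` has `D²𝒲(I)[F, F] = 0` for skew-symmetric `F`, so that
this is all that can be asked of such a density. -/
structure IsAdmissibleDensity (W : M3 → ℝ≥0∞) : Prop where
  finite : ∀ᶠ F in 𝓝 (1 : M3), W F ≠ ⊤
  contDiffAt : ContDiffAt ℝ 2 (fun F : M3 => (W F).toReal) 1
  quadForm_eq : ∀ F : M3, F.IsSymm → quadForm W F = 4 * ‖F‖ ^ 2

end Density

/-! ### The loads -/

/-- `∂φ/∂x`. -/
def dx (φ : ℝ × ℝ → ℝ) (p : ℝ × ℝ) : ℝ := fderiv ℝ φ p (1, 0)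

/-- `∂φ/∂y`. -/
def dy (φ : ℝ × ℝ → ℝ) (p : ℝ × ℝ) : ℝ := fderiv ℝ φ p (0, 1)

/-- The planar Laplacian. -/
def lap (φ : ℝ × ℝ → ℝ) (p : ℝ × ℝ) : ℝ := dx (dx φ) p + dy (dy φ) p

/-- The conditions on the planar potential `φ ∈ C²(B̄)`, which is radial with profile `ρ`. -/
structure IsAdmissiblePotential (φ : ℝ × ℝ → ℝ) (ρ : ℝ → ℝ) : Prop where
  contDiffOn : ContDiffOn ℝ 2 φ closedDisc
  radial : ∀ p ∈ closedDisc, φ p = ρ (Real.sqrt (p.1 ^ 2 + p.2 ^ 2))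
  lap_ne : ∃ p ∈ disc, lap φ p ≠ 0
  profile_one : ρ 1 = 0
  deriv_profile_one : derivWithin ρ (Icc 0 1) 1 = 0
  moment : ∫ r in (0 : ℝ)..1, r ^ 2 * derivWithin ρ (Icc 0 1) r = 0

/-- The body force `f(x, y, z) = (φ_x(x, y), φ_y(x, y), ψ(z))`. -/
def force (φ : ℝ × ℝ → ℝ) (ψ : ℝ → ℝ) (x : V3) : V3 :=
  ![dx φ (x 0, x 1), dy φ (x 0, x 1), ψ (x 2)]

/-- The load functional `ℒ(u) = ∫_Ω f · u`. -/
def load (Ω : Set V3) (f : V3 → V3) (u : V3 → V3) : ℝ := ∫ x in Ω, f x ⬝ᵥ u x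

/-- The rotation kernel: the rotations `R` with `ℒ((R - I) x) = 0`. -/
def rotationKernel (Ω : Set V3) (f : V3 → V3) : Set M3 :=
  {R | R ∈ Matrix.specialOrthogonalGroup (Fin 3) ℝ ∧ load Ω f (fun x => (R - 1) *ᵥ x) = 0}

/-! ### The limit functional -/

/-- `𝒢(u) = ∫_Ω 𝒬(𝔼(u)) - ℒ(u) - max_R ℒ((R - I) u)`, with `R` in the rotation kernel. The kernel
is compact and contains the identity, and `R ↦ ℒ((R - I) u)` is continuous for `f, u ∈ L²`, so that
the supremum is a maximum. -/
def limitEnergy (Ω : Set V3) (W : M3 → ℝ≥0∞) (f : V3 → V3) (u : V3 → V3) : ℝ :=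
  (∫ x in Ω, quadForm W (strain Ω u x)) - load Ω f u
    - sSup ((fun R : M3 => load Ω f (fun x => (R - 1) *ᵥ u x)) '' rotationKernel Ω f)

/-- `u` minimizes `𝒢` over `H¹(Ω, ℝ³)`. -/
def IsMinimizer (Ω : Set V3) (W : M3 → ℝ≥0∞) (f : V3 → V3) (u : V3 → V3) : Prop :=
  MemH1 Ω u ∧ ∀ v, MemH1 Ω v → limitEnergy Ω W f u ≤ limitEnergy Ω W f v

end CylinderGap

end

/-! The rotation kernel consists of the rotations about the axis: among the first moments of the
force only `∫ z ψ` survives. With `P` and `T` the loads of the planar force `∇φ` and of that force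
turned by a right angle, and `X` the axial load, the maximum over the kernel is `√(P² + T²) - P`.
Hence `𝒢(u) = 4‖𝔼(u)‖² - √(P² + T²) - X`, the root being the maximum of `cP - sT` over `c² + s² =
1`.

Each load is 8 times an `L²` product of `𝔼(u)` with a fixed strain (`planarLoad_eq_innerL2`,
`turnedLoad_eq_innerL2`, `axialLoad_eq_innerL2`): the force is minus the divergence of a symmetric
stress without boundary traction, and that stress is 8 times the strain of an explicit field. With
`s = x² + y²`, `k(s) = φ` and `(s g)' = -k/16`, the field is `g(s)(x, y)` for `∇φ` and `2g(s)(-y,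
x)` for the turned force. Tractions vanish because `k` and its primitive vanish at `s = 1`, the
latter by the moment condition.

The three strains are orthogonal, and the turned one satisfies `‖turned‖² = 2‖planar‖²`
(`innerL2_turnedStrain_self`): the material yields twice as much to the rotational load as to the
gradient load. Completing the square (`exists_limitEnergy_eq`) gives `𝒢(u) = 4‖𝔼(u) - c planar + s
turned - axial‖² + 2c²‖turned‖² - const`. As `turned ≠ 0` (this is where `Δφ ≠ 0` enters), a
minimizer has `c = 0` and strain `σ turned + axial`. So it differs by an infinitesimal rigid
displacement from `σ · 2g(s)(-y, x)` plus an axial field. Both `σ = 1` and `σ = -1` attain the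
minimum, which yields non-uniqueness. -/

noncomputable section

namespace CylinderGap

/-! ### Weak partial derivatives -/

section WeakPartial

variable {Ω : Set V3} {j : Fin 3} {v g : V3 → ℝ}

open scoped Convolution in
/-- A weak derivative may be tested with `C¹` functions of compact support. -/
theorem IsWeakPartial.integral_mul_fderiv (h : IsWeakPartial Ω j v g) (hΩ : IsOpen Ω)
    (hv : IntegrableOn v Ω) (hg : IntegrableOn g Ω) {ζ : V3 → ℝ} (hζ : ContDiff ℝ 1 ζ)
    (hc : HasCompactSupport ζ) (hs : tsupport ζ ⊆ Ω) :
    ∫ x in Ω, v x * fderiv ℝ ζ x (Pi.single j 1) = -∫ x in Ω, g x * ζ x := by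
  obtain ⟨δ, hδ, hδΩ⟩ := IsCompact.exists_cthickening_subset_open hc hΩ hs
  set ζ' : V3 → ℝ := fun x => fderiv ℝ ζ x (Pi.single j 1) with hζ'
  have hζ'c : Continuous ζ' := (hζ.continuous_fderiv one_ne_zero).clm_apply continuous_const
  have hζ's : HasCompactSupport ζ' := hc.fderiv_apply ℝ (Pi.single j 1)
  have huc := hζ.continuous.uniformContinuous_of_tendsto_cocompact hc.is_zero_at_infty
  have huc' := hζ'c.uniformContinuous_of_tendsto_cocompact hζ's.is_zero_at_infty
  have key : ∀ ε > 0, |(∫ x in Ω, v x * ζ' x) + ∫ x in Ω, g x * ζ x| ≤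
      ε * ((∫ x in Ω, |v x|) + ∫ x in Ω, |g x|) := by
    intro ε hε
    obtain ⟨r₁, hr₁, h₁⟩ := Metric.uniformContinuous_iff.1 huc ε hε
    obtain ⟨r₂, hr₂, h₂⟩ := Metric.uniformContinuous_iff.1 huc' ε hε
    -- Mollification at scale `r`: the bound `δ` keeps the support inside `Ω`, while `r₁` and `r₂`
    -- make the mollified function and its `j`-th derivative uniformly `ε`-close to `ζ` and `ζ'`.
    set r := min δ (min r₁ r₂) with hr
    have hr0 : 0 < r := lt_min hδ (lt_min hr₁ hr₂)
    let χ : ContDiffBump (0 : V3) := ⟨r / 2, r, half_pos hr0, half_lt_self hr0⟩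
    let L : ℝ →L[ℝ] ℝ →L[ℝ] ℝ := ContinuousLinearMap.lsmul ℝ ℝ
    set ξ : V3 → ℝ := χ.normed volume ⋆[L, volume] ζ with hξ
    have hχc : HasCompactSupport (χ.normed (volume : Measure V3)) := χ.hasCompactSupport_normed
    have hχi : LocallyIntegrable (χ.normed (volume : Measure V3)) volume :=
      χ.continuous_normed.locallyIntegrable
    have hξd : ContDiff ℝ ∞ ξ :=
      hχc.contDiff_convolution_left L χ.contDiff_normed hζ.continuous.locallyIntegrable
    have hξs : HasCompactSupport ξ := hχc.convolution L hc
    have hξt : tsupport ξ ⊆ Ω := by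
      refine subset_trans (closure_minimal ?_ Metric.isClosed_cthickening) hδΩ
      refine (support_convolution_subset L).trans ?_
      rintro _ ⟨a, ha, b, hb, rfl⟩
      rw [χ.support_normed_eq] at ha
      refine Metric.mem_cthickening_of_dist_le _ b δ _ (subset_tsupport _ hb) ?_
      have : dist a 0 < r := ha
      rw [dist_zero_right] at this
      rw [dist_eq_norm, add_sub_cancel_right]
      exact this.le.trans (min_le_left _ _)
    have hξf : ∀ x, fderiv ℝ ξ x (Pi.single j 1) = (χ.normed volume ⋆[L, volume] ζ') x := by
      intro x
      rw [(hc.hasFDerivAt_convolution_right L hχi hζ x).fderiv,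
        convolution_precompR_apply L hχi (hc.fderiv ℝ) (hζ.continuous_fderiv one_ne_zero)]
    have e₁ : ∀ x, |ξ x - ζ x| ≤ ε := fun x =>
      χ.dist_normed_convolution_le hζ.continuous.aestronglyMeasurable fun y hy =>
        (h₁ (lt_of_lt_of_le hy ((min_le_right _ _).trans (min_le_left _ _)))).le
    have e₂ : ∀ x, |fderiv ℝ ξ x (Pi.single j 1) - ζ' x| ≤ ε := fun x => by
      rw [hξf]
      exact χ.dist_normed_convolution_le hζ'c.aestronglyMeasurable fun y hy =>
        (h₂ (lt_of_lt_of_le hy ((min_le_right _ _).trans (min_le_right _ _)))).le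
    have hbd : ∀ {f w : V3 → ℝ}, IntegrableOn w Ω → Continuous f → HasCompactSupport f →
        IntegrableOn (fun x => w x * f x) Ω := by
      intro f w hw hf hfc
      obtain ⟨C, hC⟩ := hf.bounded_above_of_compact_support hfc
      exact Integrable.mul_bdd (c := C) hw hf.aestronglyMeasurable (Eventually.of_forall hC)
    have hξ'c : Continuous fun x => fderiv ℝ ξ x (Pi.single j 1) :=
      (hξd.continuous_fderiv (by simp)).clm_apply continuous_const
    have hξ's : HasCompactSupport fun x => fderiv ℝ ξ x (Pi.single j 1) :=
      hξs.fderiv_apply ℝ (Pi.single j 1)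
    have i₁ := hbd hv hζ'c hζ's
    have i₂ := hbd hg hζ.continuous hc
    have i₃ := hbd hv hξ'c hξ's
    have i₄ := hbd hg hξd.continuous hξs
    have hw := h ξ hξd hξs hξt
    have d₁ : |∫ x in Ω, (v x * ζ' x - v x * fderiv ℝ ξ x (Pi.single j 1))| ≤
        ∫ x in Ω, ε * |v x| := by
      rw [← Real.norm_eq_abs]
      refine norm_integral_le_of_norm_le (hv.abs.const_mul ε) (Eventually.of_forall fun x => ?_)
      rw [← mul_sub, Real.norm_eq_abs, abs_mul, abs_sub_comm, mul_comm]
      exact mul_le_mul_of_nonneg_right (e₂ x) (abs_nonneg _)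
    have d₂ : |∫ x in Ω, (g x * ζ x - g x * ξ x)| ≤ ∫ x in Ω, ε * |g x| := by
      rw [← Real.norm_eq_abs]
      refine norm_integral_le_of_norm_le (hg.abs.const_mul ε) (Eventually.of_forall fun x => ?_)
      rw [← mul_sub, Real.norm_eq_abs, abs_mul, abs_sub_comm, mul_comm]
      exact mul_le_mul_of_nonneg_right (e₁ x) (abs_nonneg _)
    rw [integral_sub i₁ i₃, integral_const_mul] at d₁
    rw [integral_sub i₂ i₄, integral_const_mul] at d₂
    rw [abs_le] at d₁ d₂ ⊢
    constructor <;> linarith [d₁.1, d₁.2, d₂.1, d₂.2]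
  have hM : 0 ≤ (∫ x in Ω, |v x|) + ∫ x in Ω, |g x| :=
    add_nonneg (integral_nonneg fun _ => abs_nonneg _) (integral_nonneg fun _ => abs_nonneg _)
  have h0 : |(∫ x in Ω, v x * ζ' x) + ∫ x in Ω, g x * ζ x| ≤ 0 := by
    refine le_of_forall_pos_le_add fun ε hε => ?_
    refine (key (ε / ((∫ x in Ω, |v x|) + (∫ x in Ω, |g x|) + 1)) (by positivity)).trans ?_
    rw [zero_add, div_mul_eq_mul_div, div_le_iff₀ (by positivity)]
    nlinarith
  exact eq_neg_of_add_eq_zero_left (abs_nonpos_iff.1 h0)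

/-- Classical derivatives are weak derivatives. -/
theorem isWeakPartial_of_hasLineDerivAt
    (hv : IntegrableOn v Ω) (hg : IntegrableOn g Ω)
    (h : ∀ x ∈ Ω, HasLineDerivAt ℝ v (g x) x (Pi.single j 1)) : IsWeakPartial Ω j v g := by
  intro ζ hζ hc hs
  have hζ'c : Continuous fun x => fderiv ℝ ζ x (Pi.single j 1) :=
    (hζ.continuous_fderiv (by simp)).clm_apply continuous_const
  have hζ's : HasCompactSupport fun x => fderiv ℝ ζ x (Pi.single j 1) :=
    hc.fderiv_apply ℝ (Pi.single j 1)
  have hz : ∀ x ∉ Ω, ζ x = 0 := fun x hx => image_eq_zero_of_notMem_tsupport fun h' => hx (hs h')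
  have hz' : ∀ x ∉ Ω, fderiv ℝ ζ x (Pi.single j 1) = 0 := fun x hx => by
    rw [image_eq_zero_of_notMem_tsupport fun h' => hx (hs (tsupport_fderiv_subset ℝ h'))]; rfl
  have hbd : ∀ {f w : V3 → ℝ}, IntegrableOn w Ω → Continuous f → HasCompactSupport f →
      (∀ x ∉ Ω, f x = 0) → Integrable (fun x => w x * f x) := by
    intro f w hw hf hfc hfz
    obtain ⟨C, hC⟩ := hf.bounded_above_of_compact_support hfc
    have : IntegrableOn (fun x => w x * f x) Ω :=
      Integrable.mul_bdd (c := C) hw hf.aestronglyMeasurable (Eventually.of_forall hC)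
    refine (integrableOn_iff_integrable_of_support_subset fun x hx => ?_).1 this
    by_contra hxΩ
    exact hx (by simp [hfz x hxΩ])
  -- As `ζ` vanishes off `Ω`, both integrals extend to the whole space, and line derivatives of `v`
  -- are needed only on the support of `ζ`.
  rw [setIntegral_eq_integral_of_forall_compl_eq_zero fun x hx => by rw [hz' x hx, mul_zero],
    setIntegral_eq_integral_of_forall_compl_eq_zero fun x hx => by rw [hz x hx, mul_zero]]
  exact integral_bilinear_hasLineDerivAt_right_eq_neg_left_of_integrable
    (B := ContinuousLinearMap.mul ℝ ℝ) (hbd hg hζ.continuous hc hz) (hbd hv hζ'c hζ's hz')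
    (hbd hv hζ.continuous hc hz) (fun x hx => h x (hs hx))
    (fun x _ => ((hζ.differentiable (by simp)) x).hasFDerivAt.hasLineDerivAt _)

/-- Weak derivatives are unique almost everywhere. -/
theorem IsWeakPartial.ae_eq (hΩ : IsOpen Ω) {g' : V3 → ℝ} (h : IsWeakPartial Ω j v g)
    (h' : IsWeakPartial Ω j v g') (hg : IntegrableOn g Ω) (hg' : IntegrableOn g' Ω) :
    g =ᵐ[volume.restrict Ω] g' := by
  have hd : IntegrableOn (fun x => g x - g' x) Ω := hg.sub hg'
  have := hΩ.ae_eq_zero_of_integral_contDiff_smul_eq_zero hd.locallyIntegrableOn (μ := volume) ?_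
  · rw [Filter.EventuallyEq, ae_restrict_iff' hΩ.measurableSet]
    filter_upwards [this] with x hx hxΩ using sub_eq_zero.1 (hx hxΩ)
  intro ζ hζ hc hs
  have hz : ∀ x ∉ Ω, ζ x = 0 := fun x hx => image_eq_zero_of_notMem_tsupport fun h' => hx (hs h')
  rw [← setIntegral_eq_integral_of_forall_compl_eq_zero (s := Ω)
    fun x hx => by rw [hz x hx, zero_smul]]
  obtain ⟨C, hC⟩ := hζ.continuous.bounded_above_of_compact_support hc
  have i₁ : IntegrableOn (fun x => g x * ζ x) Ω :=
    Integrable.mul_bdd (c := C) hg hζ.continuous.aestronglyMeasurable (Eventually.of_forall hC)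
  have i₂ : IntegrableOn (fun x => g' x * ζ x) Ω :=
    Integrable.mul_bdd (c := C) hg' hζ.continuous.aestronglyMeasurable (Eventually.of_forall hC)
  have e := (h ζ hζ hc hs).symm.trans (h' ζ hζ hc hs)
  calc ∫ x in Ω, ζ x • (g x - g' x) = ∫ x in Ω, (g x * ζ x - g' x * ζ x) := by
        congr 1; ext x; simp; ring
    _ = 0 := by rw [integral_sub i₁ i₂]; linarith

end WeakPartial

/-! ### Integration by parts for tangential fields, by cutoff near the boundary -/

theorem deriv_smoothTransition_of_one_lt {t : ℝ} (ht : 1 < t) :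
    deriv Real.smoothTransition t = 0 := by
  have : Real.smoothTransition =ᶠ[𝓝 t] fun _ => 1 := by
    filter_upwards [Ioi_mem_nhds ht] with y hy using
      Real.smoothTransition.one_of_one_le (le_of_lt hy)
  rw [this.deriv_eq, deriv_const]

theorem exists_bound_deriv_smoothTransition :
    ∃ M, 0 ≤ M ∧ ∀ t, |deriv Real.smoothTransition t| ≤ M := by
  have hc : Continuous (deriv Real.smoothTransition) :=
    (Real.smoothTransition.contDiff (n := 1)).continuous_deriv (by simp)
  obtain ⟨M, hM⟩ := isCompact_Icc.exists_bound_of_continuousOn (s := Icc (0 : ℝ) 1) hc.continuousOn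
  refine ⟨M, (norm_nonneg _).trans (hM 0 (by simp)), fun t => ?_⟩
  by_cases ht : t ∈ Icc (0 : ℝ) 1
  · exact hM t ht
  have hM0 : 0 ≤ M := (norm_nonneg _).trans (hM 0 (by simp))
  have : deriv Real.smoothTransition t = 0 := by
    rw [mem_Icc, not_and_or, not_le, not_le] at ht
    rcases ht with ht | ht
    · have : Real.smoothTransition =ᶠ[𝓝 t] fun _ => 0 := by
        filter_upwards [Iio_mem_nhds ht] with y hy using
          Real.smoothTransition.zero_of_nonpos (le_of_lt hy)
      rw [this.deriv_eq, deriv_const]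
    · exact deriv_smoothTransition_of_one_lt ht
  rw [this, abs_zero]
  exact hM0

/-- A `C¹` function on an open set which vanishes off a compact subset extends by zero. -/
theorem contDiff_indicator_of_compact {U K : Set V3} {f : V3 → ℝ} (hU : IsOpen U)
    (hK : IsCompact K) (hf : ContDiffOn ℝ 1 f U) (h0 : ∀ x ∈ U, x ∉ K → f x = 0)
    (hKU : K ⊆ U) :
    ContDiff ℝ 1 (U.indicator f) ∧ tsupport (U.indicator f) ⊆ K := by
  have hz : ∀ x ∉ K, U.indicator f x = 0 := fun x hx => by
    by_cases hxU : x ∈ U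
    · rw [indicator_of_mem hxU, h0 x hxU hx]
    · exact indicator_of_notMem hxU f
  refine ⟨contDiff_iff_contDiffAt.2 fun x => ?_, closure_minimal (fun x hx => ?_) hK.isClosed⟩
  · by_cases hx : x ∈ U
    · refine (hf.contDiffAt (hU.mem_nhds hx)).congr_of_eventuallyEq ?_
      filter_upwards [hU.mem_nhds hx] with y hy using indicator_of_mem hy f
    · refine (contDiffAt_const (c := (0 : ℝ))).congr_of_eventuallyEq ?_
      filter_upwards [hK.isClosed.isOpen_compl.mem_nhds fun h => hx (hKU h)] with y hy using hz y hy
  · by_contra hxK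
    exact hx (hz x hxK)

/-- Integration by parts against a field which is tangential to the boundary of `U`, the latter
being measured by the defining function `d`. -/
theorem integral_sum_mul_eq_neg_integral_mul_div {Ω U : Set V3} (hΩ : IsOpen Ω) (hU : IsOpen U)
    (hUΩ : U ⊆ Ω) (hnull : volume (Ω \ U) = 0) {d : V3 → ℝ} (hd : ContDiff ℝ 1 d)
    (hd0 : ∀ x ∈ U, 0 < d x) (hdK : ∀ ε > 0, IsCompact {x | x ∈ U ∧ ε ≤ d x})
    {v : V3 → ℝ} {g : Fin 3 → V3 → ℝ} (hv : IntegrableOn v Ω) (hg : ∀ j, IntegrableOn (g j) Ω)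
    (hw : ∀ j, IsWeakPartial Ω j v (g j))
    {F : Fin 3 → V3 → ℝ} {D : V3 → ℝ} {C : ℝ} (hF : ∀ j, ContDiffOn ℝ 1 (F j) U)
    (hFC : ∀ j, ∀ x ∈ U, |F j x| ≤ C)
    (hD : ∀ x ∈ U, ∑ j, fderiv ℝ (F j) x (Pi.single j 1) = D x) (hDC : ∀ x ∈ U, |D x| ≤ C)
    (htan : ∀ x ∈ U, |∑ j, fderiv ℝ d x (Pi.single j 1) * F j x| ≤ C * d x) :
    ∫ x in Ω, ∑ j, g j x * F j x = -∫ x in Ω, v x * D x := by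
  obtain ⟨M, hM0, hM⟩ := exists_bound_deriv_smoothTransition
  -- The cutoff is `0` where `d ≤ 1/(n+1)` and `1` where `d ≥ 2/(n+1)`. Its gradient has size `n+1`,
  -- but tangency bounds `(n+1) |∇d · F|` by `(n+1) C d ≤ 2C` on the layer where it lives. The extra
  -- term in the divergence is therefore bounded and tends to `0` pointwise, as dominated
  -- convergence requires.
  set η : ℕ → V3 → ℝ := fun n x => Real.smoothTransition ((n + 1) * d x - 1) with hη
  set ζ : ℕ → Fin 3 → V3 → ℝ := fun n j => U.indicator fun x => η n x * F j x with hζ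
  have hηd : ∀ n, ContDiff ℝ 1 (η n) := fun n =>
    Real.smoothTransition.contDiff.comp ((contDiff_const.mul hd).sub contDiff_const)
  have hηf : ∀ n x (e : V3), fderiv ℝ (η n) x e =
      deriv Real.smoothTransition ((n + 1) * d x - 1) * ((n + 1) * fderiv ℝ d x e) := by
    intro n x e
    have h1 : HasFDerivAt (fun x => ((n : ℝ) + 1) * d x - 1) (((n : ℝ) + 1) • fderiv ℝ d x) x :=
      (((hd.differentiable (by simp)) x).hasFDerivAt.const_mul _).sub_const _
    have h2 : HasDerivAt Real.smoothTransition
        (deriv Real.smoothTransition ((n + 1) * d x - 1)) ((n + 1) * d x - 1) :=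
      ((Real.smoothTransition.contDiff (n := 1)).differentiable (by simp) _).hasDerivAt
    have h3 := h2.comp_hasFDerivAt x h1
    rw [show fderiv ℝ (η n) x = _ from h3.fderiv]
    simp
  have hζp : ∀ n j, ContDiff ℝ 1 (ζ n j) ∧
      tsupport (ζ n j) ⊆ {x | x ∈ U ∧ 1 / ((n : ℝ) + 1) ≤ d x} := by
    intro n j
    refine contDiff_indicator_of_compact hU (hdK _ (by positivity))
      ((hηd n).contDiffOn.mul (hF j)) (fun x hx hxK => ?_) (fun x hx => hx.1)
    have : d x < 1 / ((n : ℝ) + 1) := by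
      by_contra hlt
      exact hxK ⟨hx, not_lt.1 hlt⟩
    rw [lt_div_iff₀ (by positivity)] at this
    simp only [hη]
    rw [Real.smoothTransition.zero_of_nonpos (by linarith), zero_mul]
  have hζc : ∀ n j, HasCompactSupport (ζ n j) := fun n j =>
    (hdK _ (by positivity)).of_isClosed_subset (isClosed_tsupport _) (hζp n j).2
  have hζU : ∀ n j, ∀ x ∈ U, ζ n j x = η n x * F j x := fun n j x hx => indicator_of_mem hx _
  have hζf : ∀ n, ∀ x ∈ U, ∑ j, fderiv ℝ (ζ n j) x (Pi.single j 1) = η n x * D x +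
      deriv Real.smoothTransition ((n + 1) * d x - 1) *
        ((n + 1) * ∑ j, fderiv ℝ d x (Pi.single j 1) * F j x) := by
    intro n x hx
    rw [← hD x hx, Finset.mul_sum, Finset.mul_sum, Finset.mul_sum, ← Finset.sum_add_distrib]
    refine Finset.sum_congr rfl fun j _ => ?_
    have he : ζ n j =ᶠ[𝓝 x] fun x => η n x * F j x := by
      filter_upwards [hU.mem_nhds hx] with y hy using hζU n j y hy
    rw [he.fderiv_eq, fderiv_fun_mul ((hηd n).differentiable (by simp) x)
      (((hF j).contDiffAt (hU.mem_nhds hx)).differentiableAt (by simp))]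
    simp only [add_apply, smul_apply, smul_eq_mul, hηf]
    ring
  have hUae : ∀ᵐ x ∂volume.restrict Ω, x ∈ U := by
    rw [ae_restrict_iff' hΩ.measurableSet, ae_iff]
    convert hnull using 2
    ext x; simp
  have hζb : ∀ n j, ∃ B, ∀ x, ‖ζ n j x‖ ≤ B := fun n j =>
    (hζp n j).1.continuous.bounded_above_of_compact_support (hζc n j)
  have hζ'c : ∀ n j, Continuous fun x => fderiv ℝ (ζ n j) x (Pi.single j 1) := fun n j =>
    ((hζp n j).1.continuous_fderiv one_ne_zero).clm_apply continuous_const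
  have hζ'b : ∀ n j, ∃ B, ∀ x, ‖fderiv ℝ (ζ n j) x (Pi.single j 1)‖ ≤ B := fun n j =>
    (hζ'c n j).bounded_above_of_compact_support ((hζc n j).fderiv_apply ℝ _)
  have hid : ∀ n, ∫ x in Ω, v x * ∑ j, fderiv ℝ (ζ n j) x (Pi.single j 1) =
      -∫ x in Ω, ∑ j, g j x * ζ n j x := by
    intro n
    simp_rw [Finset.mul_sum]
    rw [integral_finsetSum _ fun j _ => ?_, integral_finsetSum _ fun j _ => ?_,
      ← Finset.sum_neg_distrib]
    · refine Finset.sum_congr rfl fun j _ => ?_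
      exact (hw j).integral_mul_fderiv hΩ hv (hg j) (hζp n j).1 (hζc n j)
        ((hζp n j).2.trans fun x hx => hUΩ hx.1)
    · obtain ⟨B, hB⟩ := hζb n j
      exact Integrable.mul_bdd (c := B) (hg j) (hζp n j).1.continuous.aestronglyMeasurable
        (Eventually.of_forall hB)
    · obtain ⟨B, hB⟩ := hζ'b n j
      exact Integrable.mul_bdd (c := B) hv (hζ'c n j).aestronglyMeasurable
        (Eventually.of_forall hB)
  have hlarge : ∀ x ∈ U, ∀ᶠ n : ℕ in atTop, 1 < ((n : ℝ) + 1) * d x - 1 := by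
    intro x hx
    obtain ⟨N, hN⟩ := exists_nat_gt (2 / d x)
    filter_upwards [eventually_ge_atTop N] with n hn
    have h1 : (N : ℝ) ≤ n := by exact_mod_cast hn
    have h2 : 2 / d x < (n : ℝ) + 1 := by linarith
    rw [div_lt_iff₀ (hd0 x hx)] at h2
    linarith
  have hη1 : ∀ n x, |η n x| ≤ 1 := fun n x => by
    rw [abs_of_nonneg (Real.smoothTransition.nonneg _)]
    exact Real.smoothTransition.le_one _
  have lim₁ : Tendsto (fun n => ∫ x in Ω, ∑ j, g j x * ζ n j x) atTop
      (𝓝 (∫ x in Ω, ∑ j, g j x * F j x)) := by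
    refine tendsto_integral_of_dominated_convergence (fun x => ∑ j, |g j x| * C) (fun n => ?_)
      (integrable_finsetSum _ fun j _ => (hg j).abs.mul_const C) (fun n => ?_) ?_
    · exact Finset.aestronglyMeasurable_fun_sum _ fun j _ =>
        (hg j).aestronglyMeasurable.mul (hζp n j).1.continuous.aestronglyMeasurable
    · filter_upwards [hUae] with x hx
      refine (norm_sum_le _ _).trans (Finset.sum_le_sum fun j _ => ?_)
      rw [norm_mul, Real.norm_eq_abs, Real.norm_eq_abs, hζU n j x hx, abs_mul]
      refine mul_le_mul_of_nonneg_left ?_ (abs_nonneg _)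
      have := mul_le_mul (hη1 n x) (hFC j x hx) (abs_nonneg _) zero_le_one
      linarith
    · filter_upwards [hUae] with x hx
      refine tendsto_const_nhds.congr' ?_
      filter_upwards [hlarge x hx] with n hn
      refine Finset.sum_congr rfl fun j _ => ?_
      rw [hζU n j x hx]
      simp only [hη]
      rw [Real.smoothTransition.one_of_one_le hn.le, one_mul]
  have lim₂ : Tendsto (fun n => ∫ x in Ω, v x * ∑ j, fderiv ℝ (ζ n j) x (Pi.single j 1)) atTop
      (𝓝 (∫ x in Ω, v x * D x)) := by
    refine tendsto_integral_of_dominated_convergence (fun x => |v x| * (C + M * (2 * C)))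
      (fun n => ?_) (hv.abs.mul_const _) (fun n => ?_) ?_
    · exact hv.aestronglyMeasurable.mul (Finset.aestronglyMeasurable_fun_sum _ fun j _ =>
        (hζ'c n j).aestronglyMeasurable)
    · filter_upwards [hUae] with x hx
      have hC : 0 ≤ C := (abs_nonneg _).trans (hDC x hx)
      rw [norm_mul, Real.norm_eq_abs, Real.norm_eq_abs, hζf n x hx]
      refine mul_le_mul_of_nonneg_left ((abs_add_le _ _).trans (add_le_add ?_ ?_)) (abs_nonneg _)
      · rw [abs_mul]
        have := mul_le_mul (hη1 n x) (hDC x hx) (abs_nonneg _) zero_le_one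
        linarith
      · by_cases hlt : 1 < ((n : ℝ) + 1) * d x - 1
        · rw [deriv_smoothTransition_of_one_lt hlt, zero_mul, abs_zero]
          positivity
        · rw [abs_mul]
          refine mul_le_mul (hM _) ?_ (abs_nonneg _) hM0
          rw [abs_mul, abs_of_nonneg (by positivity : (0 : ℝ) ≤ (n : ℝ) + 1)]
          calc ((n : ℝ) + 1) * |∑ j, fderiv ℝ d x (Pi.single j 1) * F j x|
              ≤ ((n : ℝ) + 1) * (C * d x) :=
                mul_le_mul_of_nonneg_left (htan x hx) (by positivity)
            _ = ((n + 1) * d x) * C := by ring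
            _ ≤ 2 * C := mul_le_mul_of_nonneg_right (by linarith [not_lt.1 hlt]) hC
    · filter_upwards [hUae] with x hx
      refine tendsto_const_nhds.congr' ?_
      filter_upwards [hlarge x hx] with n hn
      rw [hζf n x hx, deriv_smoothTransition_of_one_lt hn]
      simp only [hη]
      rw [Real.smoothTransition.one_of_one_le hn.le, one_mul, zero_mul, add_zero]
  have := tendsto_nhds_unique (lim₂.congr hid) lim₁.neg
  linarith

/-! ### Weak gradients -/

section WeakGradient

variable {Ω : Set V3} {u u' : V3 → V3} {A A' : V3 → M3}

theorem IsWeakPartial.add {j : Fin 3} {v v' g g' : V3 → ℝ} (h : IsWeakPartial Ω j v g)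
    (h' : IsWeakPartial Ω j v' g') (hv : IntegrableOn v Ω) (hv' : IntegrableOn v' Ω)
    (hg : IntegrableOn g Ω) (hg' : IntegrableOn g' Ω) :
    IsWeakPartial Ω j (fun x => v x + v' x) (fun x => g x + g' x) := by
  intro ζ hζ hc hs
  have hbd : ∀ {f w : V3 → ℝ}, IntegrableOn w Ω → Continuous f → HasCompactSupport f →
      Integrable (fun x => w x * f x) (volume.restrict Ω) := by
    intro f w hw hf hfc
    obtain ⟨C, hC⟩ := hf.bounded_above_of_compact_support hfc
    exact Integrable.mul_bdd (c := C) hw hf.aestronglyMeasurable (Eventually.of_forall hC)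
  have hζ'c : Continuous fun x => fderiv ℝ ζ x (Pi.single j 1) :=
    (hζ.continuous_fderiv (by simp)).clm_apply continuous_const
  have hζ's : HasCompactSupport fun x => fderiv ℝ ζ x (Pi.single j 1) :=
    hc.fderiv_apply ℝ (Pi.single j 1)
  simp_rw [add_mul]
  rw [integral_add (hbd hv hζ'c hζ's) (hbd hv' hζ'c hζ's),
    integral_add (hbd hg hζ.continuous hc) (hbd hg' hζ.continuous hc), h ζ hζ hc hs,
    h' ζ hζ hc hs, neg_add]

theorem IsWeakPartial.const_mul {j : Fin 3} {v g : V3 → ℝ} (h : IsWeakPartial Ω j v g) (c : ℝ) :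
    IsWeakPartial Ω j (fun x => c * v x) (fun x => c * g x) := by
  intro ζ hζ hc hs
  simp_rw [mul_assoc]
  rw [integral_const_mul, integral_const_mul, h ζ hζ hc hs, mul_neg]

theorem IsWeakGradient.memH1 (h : IsWeakGradient Ω u A) : MemH1 Ω u := ⟨A, h⟩

theorem MemH1.isWeakGradient_weakGrad (h : MemH1 Ω u) :
    IsWeakGradient Ω u (weakGrad Ω u) := by
  rw [weakGrad, dif_pos h]
  exact h.choose_spec

theorem IsWeakGradient.const_smul (h : IsWeakGradient Ω u A) (c : ℝ) :
    IsWeakGradient Ω (c • u) (c • A) where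
  memLp i := (h.memLp i).const_mul c
  grad_memLp i j := (h.grad_memLp i j).const_mul c
  isWeakPartial i j := (h.isWeakPartial i j).const_mul c

variable [IsFiniteMeasure (volume.restrict Ω)]

theorem IsWeakGradient.integrable (h : IsWeakGradient Ω u A) (i : Fin 3) :
    IntegrableOn (fun x => u x i) Ω :=
  (h.memLp i).integrable (by norm_num)

theorem IsWeakGradient.grad_integrable (h : IsWeakGradient Ω u A) (i j : Fin 3) :
    IntegrableOn (fun x => A x i j) Ω :=
  (h.grad_memLp i j).integrable (by norm_num)

theorem IsWeakGradient.add (h : IsWeakGradient Ω u A) (h' : IsWeakGradient Ω u' A') :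
    IsWeakGradient Ω (u + u') (A + A') where
  memLp i := (h.memLp i).add (h'.memLp i)
  grad_memLp i j := (h.grad_memLp i j).add (h'.grad_memLp i j)
  isWeakPartial i j := (h.isWeakPartial i j).add (h'.isWeakPartial i j) (h.integrable i)
    (h'.integrable i) (h.grad_integrable i j) (h'.grad_integrable i j)

theorem IsWeakGradient.sub (h : IsWeakGradient Ω u A) (h' : IsWeakGradient Ω u' A') :
    IsWeakGradient Ω (u - u') (A - A') := by
  have := h.add (h'.const_smul (-1))
  simpa [sub_eq_add_neg] using this

/-- The symmetric part of a matrix field. -/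
def symPart (A : V3 → M3) (x : V3) : M3 := (1 / 2 : ℝ) • (A x + (A x)ᵀ)

/-- Uniqueness of weak derivatives: the gradient chosen by `weakGrad` may be replaced by any
explicit one. -/
theorem IsWeakGradient.strain_ae_eq (hΩ : IsOpen Ω) (h : IsWeakGradient Ω u A) :
    strain Ω u =ᵐ[volume.restrict Ω] symPart A := by
  have hG := h.memH1.isWeakGradient_weakGrad
  have he : ∀ i j, ∀ᵐ x ∂volume.restrict Ω, weakGrad Ω u x i j = A x i j := fun i j =>
    (hG.isWeakPartial i j).ae_eq hΩ (h.isWeakPartial i j) (hG.grad_integrable i j)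
      (h.grad_integrable i j)
  filter_upwards [ae_all_iff.2 fun i => ae_all_iff.2 (he i)] with x hx
  have : weakGrad Ω u x = A x := by ext i j; exact hx i j
  rw [strain, symPart, this]

end WeakGradient

/-! ### The radial profile -/

/-- The data attached to a radial potential `φ`, in terms of the variable `s = x² + y²`: the profile
`k` and the function `g` for which `2 g(s) (-y, x)` is the planar displacement caused by the
rotated force. -/
structure IsProfile (φ : ℝ × ℝ → ℝ) (k g : ℝ → ℝ) (C : ℝ) : Prop where
  eq_profile : ∀ p ∈ disc, φ p = k (p.1 ^ 2 + p.2 ^ 2)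
  contDiffOn_potential : ContDiffOn ℝ 1 φ disc
  contDiffOn : ContDiffOn ℝ 1 k (Ioo 0 1)
  abs_dx_le : ∀ p ∈ disc, |dx φ p| ≤ C
  abs_dy_le : ∀ p ∈ disc, |dy φ p| ≤ C
  abs_le : ∀ s ∈ Ico (0 : ℝ) 1, |k s| ≤ C * (1 - s)
  contDiffOn_avg : ContDiffOn ℝ 1 g (Ioo 0 1)
  abs_avg_le : ∀ s ∈ Ico (0 : ℝ) 1, |g s| ≤ C
  abs_avg_sub_le : ∀ s ∈ Ico (0 : ℝ) 1, |g s - g 0| ≤ C * Real.sqrt s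
  mul_deriv_avg : ∀ s ∈ Ioo (0 : ℝ) 1, s * deriv g s = -k s / 16 - g s
  abs_defect_le : ∀ s ∈ Ioo (0 : ℝ) 1, Real.sqrt s * |-k s / 16 - g s| ≤ C * (s * (1 - s))
  defect_ne : ∃ s ∈ Ioo (0 : ℝ) 1, -k s / 16 - g s ≠ 0

theorem isOpen_disc : IsOpen disc :=
  isOpen_lt (by fun_prop) continuous_const

theorem disc_subset_closedDisc : disc ⊆ closedDisc := by
  intro p hp
  have hp : p.1 ^ 2 + p.2 ^ 2 < 1 := hp
  exact le_of_lt hp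

theorem isCompact_closedDisc : IsCompact closedDisc := by
  refine Metric.isCompact_of_isClosed_isBounded (isClosed_le (by fun_prop) continuous_const)
    ((Metric.isBounded_closedBall (x := (0 : ℝ × ℝ)) (r := 1)).subset fun p hp => ?_)
  have hp : p.1 ^ 2 + p.2 ^ 2 ≤ 1 := hp
  rw [mem_closedBall_zero_iff, Prod.norm_def, max_le_iff, Real.norm_eq_abs, Real.norm_eq_abs,
    abs_le_one_iff_mul_self_le_one, abs_le_one_iff_mul_self_le_one]
  constructor <;> nlinarith [sq_nonneg p.1, sq_nonneg p.2]

theorem convex_closedDisc : Convex ℝ closedDisc := by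
  intro p hp q hq a b ha hb hab
  have hp : p.1 ^ 2 + p.2 ^ 2 ≤ 1 := hp
  have hq : q.1 ^ 2 + q.2 ^ 2 ≤ 1 := hq
  change (a * p.1 + b * q.1) ^ 2 + (a * p.2 + b * q.2) ^ 2 ≤ 1
  have hb' : b = 1 - a := by linarith
  subst hb'
  nlinarith [mul_nonneg ha hb, sq_nonneg (p.1 - q.1), sq_nonneg (p.2 - q.2),
    mul_nonneg (mul_nonneg ha hb) (add_nonneg (sq_nonneg (p.1 - q.1)) (sq_nonneg (p.2 - q.2)))]

theorem uniqueDiffOn_closedDisc : UniqueDiffOn ℝ closedDisc :=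
  uniqueDiffOn_convex convex_closedDisc
    ⟨0, interior_maximal disc_subset_closedDisc isOpen_disc (by simp [disc])⟩

theorem fderivWithin_closedDisc (φ : ℝ × ℝ → ℝ) {p : ℝ × ℝ} (hp : p ∈ disc) :
    fderivWithin ℝ φ closedDisc p = fderiv ℝ φ p :=
  fderivWithin_of_mem_nhds (mem_of_superset (isOpen_disc.mem_nhds hp) disc_subset_closedDisc)

theorem mk_zero_mem_closedDisc {r : ℝ} (hr : r ∈ Icc (0 : ℝ) 1) : (r, (0 : ℝ)) ∈ closedDisc := by
  change r ^ 2 + 0 ^ 2 ≤ 1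
  nlinarith [hr.1, hr.2]

section Profile

variable {φ : ℝ × ℝ → ℝ} {ρ : ℝ → ℝ}

theorem IsAdmissiblePotential.profile_eq (h : IsAdmissiblePotential φ ρ) {r : ℝ}
    (hr : r ∈ Icc (0 : ℝ) 1) : ρ r = φ (r, 0) := by
  rw [h.radial _ (mk_zero_mem_closedDisc hr)]
  simp [Real.sqrt_sq hr.1]

theorem IsAdmissiblePotential.exists_bound (h : IsAdmissiblePotential φ ρ) :
    ∃ C, 0 ≤ C ∧ (∀ p ∈ closedDisc, ‖fderivWithin ℝ φ closedDisc p‖ ≤ C) ∧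
      ∀ r ∈ Icc (0 : ℝ) 1, ∀ r' ∈ Icc (0 : ℝ) 1, |φ (r, 0) - φ (r', 0)| ≤ C * |r - r'| := by
  obtain ⟨C, hC⟩ := isCompact_closedDisc.exists_bound_of_continuousOn
    (h.contDiffOn.continuousOn_fderivWithin uniqueDiffOn_closedDisc (by simp))
  have h0 : (0 : ℝ × ℝ) ∈ closedDisc := by simp [closedDisc]
  refine ⟨C, (norm_nonneg _).trans (hC 0 h0), hC, fun r hr r' hr' => ?_⟩
  have := convex_closedDisc.norm_image_sub_le_of_norm_fderivWithin_le
    (h.contDiffOn.differentiableOn (by simp)) hC (mk_zero_mem_closedDisc hr')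
    (mk_zero_mem_closedDisc hr)
  simpa using this

/-- The profile in the variable `s = x² + y²`, continued by constants. -/
def sqProfile (φ : ℝ × ℝ → ℝ) (s : ℝ) : ℝ := φ (Real.sqrt (min s 1), 0)

theorem sqrt_min_mem (s : ℝ) : Real.sqrt (min s 1) ∈ Icc (0 : ℝ) 1 :=
  ⟨Real.sqrt_nonneg _, Real.sqrt_le_one.2 (min_le_right _ _)⟩

theorem IsAdmissiblePotential.continuous_sqProfile (h : IsAdmissiblePotential φ ρ) :
    Continuous (sqProfile φ) :=
  h.contDiffOn.continuousOn.comp_continuous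
    (f := fun s : ℝ => (Real.sqrt (min s 1), (0 : ℝ))) (by fun_prop)
    fun s => mk_zero_mem_closedDisc (sqrt_min_mem s)

theorem sqProfile_of_le_one {s : ℝ} (hs : s ≤ 1) : sqProfile φ s = φ (Real.sqrt s, 0) := by
  rw [sqProfile, min_eq_left hs]

theorem IsAdmissiblePotential.eq_sqProfile (h : IsAdmissiblePotential φ ρ) {p : ℝ × ℝ}
    (hp : p ∈ closedDisc) : φ p = sqProfile φ (p.1 ^ 2 + p.2 ^ 2) := by
  have hp1 : p.1 ^ 2 + p.2 ^ 2 ≤ 1 := hp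
  rw [sqProfile_of_le_one hp1, h.radial p hp,
    h.profile_eq ⟨Real.sqrt_nonneg _, Real.sqrt_le_one.2 hp1⟩]

/-- The primitive of the profile. -/
def profilePrimitive (φ : ℝ × ℝ → ℝ) (s : ℝ) : ℝ := ∫ t in (0 : ℝ)..s, sqProfile φ t

theorem IsAdmissiblePotential.hasDerivAt_primitive (h : IsAdmissiblePotential φ ρ) (s : ℝ) :
    HasDerivAt (profilePrimitive φ) (sqProfile φ s) s :=
  intervalIntegral.integral_hasDerivAt_right (h.continuous_sqProfile.intervalIntegrable _ _)
    (h.continuous_sqProfile.stronglyMeasurableAtFilter _ _) h.continuous_sqProfile.continuousAt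

theorem profilePrimitive_zero : profilePrimitive φ 0 = 0 := by simp [profilePrimitive]

/-- This is the moment condition in the variable `s`. With `K` the primitive, `K(r²)` has derivative
`2rρ`, so `r²ρ - K(r²)` is a primitive of `r²ρ'`; moreover `ρ(1) = 0`. -/
theorem IsAdmissiblePotential.primitive_one (h : IsAdmissiblePotential φ ρ) :
    profilePrimitive φ 1 = 0 := by
  have hdw : ∀ r ∈ Icc (0 : ℝ) 1,
      HasDerivWithinAt ρ (fderivWithin ℝ φ closedDisc (r, 0) (1, 0)) (Icc 0 1) r := by
    intro r hr
    have h1 := (h.contDiffOn.differentiableOn (by simp) _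
      (mk_zero_mem_closedDisc hr)).hasFDerivWithinAt
    have h2 : HasDerivWithinAt (fun r : ℝ => (r, (0 : ℝ))) (1, 0) (Icc 0 1) r :=
      (hasDerivWithinAt_id _ _).prodMk (hasDerivWithinAt_const _ _ _)
    exact (h1.comp_hasDerivWithinAt r h2 fun t ht => mk_zero_mem_closedDisc ht).congr
      (fun t ht => h.profile_eq ht) (h.profile_eq hr)
  have hde : ∀ r ∈ Icc (0 : ℝ) 1, derivWithin ρ (Icc 0 1) r =
      fderivWithin ℝ φ closedDisc (r, 0) (1, 0) := fun r hr =>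
    (hdw r hr).derivWithin (uniqueDiffOn_Icc zero_lt_one r hr)
  have hcont : ContinuousOn (fun r : ℝ => fderivWithin ℝ φ closedDisc (r, 0) (1, 0)) (Icc 0 1) := by
    have := (h.contDiffOn.continuousOn_fderivWithin uniqueDiffOn_closedDisc (by simp)).comp
      (f := fun r : ℝ => (r, (0 : ℝ))) (by fun_prop) fun t ht => mk_zero_mem_closedDisc ht
    exact this.clm_apply continuousOn_const
  have hft := intervalIntegral.integral_eq_sub_of_hasDerivAt_of_le (zero_le_one (α := ℝ))
    (f := fun r => r ^ 2 * ρ r - profilePrimitive φ (r ^ 2))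
    (f' := fun r => r ^ 2 * derivWithin ρ (Icc 0 1) r) ?_ ?_ ?_
  · rw [h.moment] at hft
    simp only [one_pow, h.profile_one] at hft
    simp [profilePrimitive_zero] at hft
    exact hft
  · refine ContinuousOn.sub (ContinuousOn.mul (by fun_prop) fun r hr =>
      (hdw r hr).continuousWithinAt) ?_
    exact ((continuous_iff_continuousAt.2 fun s => (h.hasDerivAt_primitive s).continuousAt).comp
      (continuous_pow 2)).continuousOn
  · intro r hr
    have hr' := Ioo_subset_Icc_self hr
    have h1 : HasDerivAt ρ (derivWithin ρ (Icc 0 1) r) r := by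
      rw [hde r hr']
      exact (hdw r hr').hasDerivAt (Icc_mem_nhds hr.1 hr.2)
    have h2 : HasDerivAt (fun r : ℝ => r ^ 2) (2 * r) r := by simpa using hasDerivAt_pow 2 r
    have h3 := (h2.mul h1).sub ((h.hasDerivAt_primitive (r ^ 2)).comp r h2)
    convert! h3 using 1
    rw [sqProfile_of_le_one (by nlinarith [hr.1, hr.2]), Real.sqrt_sq hr.1.le, h.profile_eq hr']
    ring
  · refine ContinuousOn.intervalIntegrable ?_
    rw [uIcc_of_le zero_le_one]
    exact ContinuousOn.mul (by fun_prop) (hcont.congr hde)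

/-- Minus one sixteenth of the mean of the profile over `(0, s)`. -/
def profileMean (φ : ℝ × ℝ → ℝ) (s : ℝ) : ℝ :=
  if s = 0 then -sqProfile φ 0 / 16 else -profilePrimitive φ s / (16 * s)

/-- The equation `(s g)' = -k/16`, solved for `g'`. -/
theorem IsAdmissiblePotential.hasDerivAt_profileMean (h : IsAdmissiblePotential φ ρ) {s : ℝ}
    (hs : s ≠ 0) :
    HasDerivAt (profileMean φ) ((-sqProfile φ s / 16 - profileMean φ s) / s) s := by
  have h1 := (h.hasDerivAt_primitive s).neg.div ((hasDerivAt_id s).const_mul 16)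
    (by simpa using hs)
  have h2 : profileMean φ =ᶠ[𝓝 s] fun s => -profilePrimitive φ s / (16 * s) := by
    filter_upwards [isOpen_ne.mem_nhds hs] with t ht using if_neg ht
  refine (h1.congr_of_eventuallyEq h2).congr_deriv ?_
  simp only [profileMean, if_neg hs, Pi.neg_apply, id]
  field_simp

/-- One of `s`, `1 - s` is at least `1/2`, and the bound available on that half supplies the other
factor; hence the constant `2C`. -/
theorem sqrt_mul_defect_le {C s q : ℝ} (hC : 0 ≤ C) (hs : s ∈ Ioo (0 : ℝ) 1)
    (h₀ : |q| ≤ C * Real.sqrt s) (h₁ : 1 / 2 < s → |q| ≤ C * (1 - s)) :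
    Real.sqrt s * |q| ≤ 2 * C * (s * (1 - s)) := by
  have hr := Real.sqrt_nonneg s
  have hss := Real.mul_self_sqrt hs.1.le
  rcases le_or_gt s (1 / 2) with h | h
  · have := mul_le_mul_of_nonneg_left h₀ hr
    have e : Real.sqrt s * (C * Real.sqrt s) = C * s := by
      rw [mul_left_comm, hss]
    rw [e] at this
    nlinarith [mul_nonneg hC hs.1.le]
  · have h1 := h₁ h
    have h2 : Real.sqrt s ≤ 1 := Real.sqrt_le_one.2 hs.2.le
    have h3 : Real.sqrt s * |q| ≤ 1 * |q| := mul_le_mul_of_nonneg_right h2 (abs_nonneg _)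
    nlinarith [mul_nonneg hC (sub_nonneg.2 hs.2.le)]

/-- All bounds come from the Lipschitz continuity of `φ`. Near `s = 1` both `k` and its primitive
are `O(1 - s)`, since they vanish there. Near `s = 0` both `-k/16` and `g` are within `O(√s)` of
their common value, so the defect `-k/16 - g` is `O(√s)`. -/
theorem IsAdmissiblePotential.exists_isProfile (h : IsAdmissiblePotential φ ρ) :
    ∃ C, IsProfile φ (sqProfile φ) (profileMean φ) C := by
  obtain ⟨C, hC, hfd, hlip⟩ := h.exists_bound
  have h1mem : (1 : ℝ) ∈ Icc (0 : ℝ) 1 := by simp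
  have h0mem : (0 : ℝ) ∈ Icc (0 : ℝ) 1 := by simp
  have hsq : ∀ s ∈ Icc (0 : ℝ) 1, Real.sqrt s ∈ Icc (0 : ℝ) 1 := fun s hs =>
    ⟨Real.sqrt_nonneg _, Real.sqrt_le_one.2 hs.2⟩
  have hk1 : ∀ s ∈ Icc (0 : ℝ) 1, |sqProfile φ s| ≤ C * (1 - s) := by
    intro s hs
    have h1 := hlip _ (hsq s hs) 1 h1mem
    rw [← h.profile_eq h1mem, h.profile_one, sub_zero, abs_sub_comm,
      abs_of_nonneg (sub_nonneg.2 (hsq s hs).2)] at h1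
    rw [sqProfile_of_le_one hs.2]
    refine h1.trans (mul_le_mul_of_nonneg_left ?_ hC)
    nlinarith [Real.mul_self_sqrt hs.1, (hsq s hs).1, (hsq s hs).2]
  have hk0 : ∀ s ∈ Icc (0 : ℝ) 1, |sqProfile φ s - sqProfile φ 0| ≤ C * Real.sqrt s := by
    intro s hs
    have h1 := hlip _ (hsq s hs) 0 h0mem
    rwa [sub_zero, abs_of_nonneg (hsq s hs).1, ← sqProfile_of_le_one (φ := φ) hs.2,
      show φ (0, 0) = sqProfile φ 0 by simp [sqProfile]] at h1
  have hint : ∀ a b, IntervalIntegrable (sqProfile φ) volume a b := fun a b =>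
    h.continuous_sqProfile.intervalIntegrable a b
  have hK0 : ∀ s ∈ Icc (0 : ℝ) 1,
      |profilePrimitive φ s - s * sqProfile φ 0| ≤ C * Real.sqrt s * s := by
    intro s hs
    have e : profilePrimitive φ s - s * sqProfile φ 0 =
        ∫ t in (0 : ℝ)..s, (sqProfile φ t - sqProfile φ 0) := by
      rw [intervalIntegral.integral_sub (hint _ _) (by simp)]
      simp [profilePrimitive]
    have := intervalIntegral.norm_integral_le_of_norm_le_const (a := 0) (b := s)
      (f := fun t => sqProfile φ t - sqProfile φ 0) (C := C * Real.sqrt s) fun t ht => by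
        rw [uIoc_of_le hs.1] at ht
        exact (hk0 t ⟨ht.1.le, ht.2.trans hs.2⟩).trans
          (mul_le_mul_of_nonneg_left (Real.sqrt_le_sqrt ht.2) hC)
    rwa [← e, sub_zero, abs_of_nonneg hs.1] at this
  have hK1 : ∀ s ∈ Icc (0 : ℝ) 1, |profilePrimitive φ s| ≤ C * (1 - s) := by
    intro s hs
    have e : profilePrimitive φ s = -∫ t in s..1, sqProfile φ t := by
      have := intervalIntegral.integral_add_adjacent_intervals (hint 0 s) (hint s 1)
      have h1 := h.primitive_one
      rw [profilePrimitive] at h1 ⊢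
      linarith
    have := intervalIntegral.norm_integral_le_of_norm_le_const (a := s) (b := 1)
      (f := sqProfile φ) (C := C) fun t ht => by
        rw [uIoc_of_le hs.2] at ht
        have := hk1 t ⟨hs.1.trans ht.1.le, ht.2⟩
        have h2 : 0 ≤ t := hs.1.trans ht.1.le
        rw [Real.norm_eq_abs]
        nlinarith
    rwa [e, abs_neg, ← abs_of_nonneg (sub_nonneg.2 hs.2)]
  have hg0 : ∀ s ∈ Icc (0 : ℝ) 1, |profileMean φ s - profileMean φ 0| ≤ C / 16 * Real.sqrt s := by
    intro s hs
    rcases eq_or_ne s 0 with rfl | hs0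
    · simp
    have hpos : 0 < s := lt_of_le_of_ne hs.1 hs0.symm
    have e : profileMean φ s - profileMean φ 0 =
        -((profilePrimitive φ s - s * sqProfile φ 0) / (16 * s)) := by
      simp only [profileMean, if_neg hs0, if_true]
      field_simp
      ring
    rw [e, abs_neg, abs_div, abs_of_pos (by positivity : 0 < 16 * s), div_le_iff₀ (by positivity)]
    refine (hK0 s hs).trans (le_of_eq ?_)
    ring
  have hgz : |profileMean φ 0| ≤ C / 16 := by
    have := hk1 0 h0mem
    simp only [profileMean, if_true]
    rw [abs_div, abs_neg, abs_of_pos (by norm_num : (0 : ℝ) < 16)]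
    linarith
  have hdq : ∀ s ∈ Ioo (0 : ℝ) 1, |(-sqProfile φ s / 16 - profileMean φ s)| ≤ C * Real.sqrt s := by
    intro s hs
    have hs' := Ioo_subset_Icc_self hs
    have e : -sqProfile φ s / 16 - profileMean φ s =
        -((sqProfile φ s - sqProfile φ 0) / 16 + (profileMean φ s - profileMean φ 0)) := by
      have : profileMean φ 0 = -sqProfile φ 0 / 16 := by simp [profileMean]
      rw [this]; ring
    rw [e, abs_neg]
    refine (abs_add_le _ _).trans ?_
    rw [abs_div, abs_of_pos (by norm_num : (0 : ℝ) < 16)]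
    have := hk0 s hs'
    have := hg0 s hs'
    have := mul_nonneg hC (Real.sqrt_nonneg s)
    linarith
  have hdq1 : ∀ s ∈ Ioo (0 : ℝ) 1, 1 / 2 < s →
      |(-sqProfile φ s / 16 - profileMean φ s)| ≤ C * (1 - s) := by
    intro s hs hs2
    have hs' := Ioo_subset_Icc_self hs
    have h1 : |profileMean φ s| ≤ C * (1 - s) / 8 := by
      rw [profileMean, if_neg hs.1.ne', abs_div, abs_neg,
        abs_of_pos (by linarith : 0 < 16 * s), div_le_iff₀ (by linarith)]
      have := mul_nonneg hC (sub_nonneg.2 hs.2.le)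
      nlinarith [hK1 s hs']
    refine (abs_sub _ _).trans ?_
    rw [abs_div, abs_neg, abs_of_pos (by norm_num : (0 : ℝ) < 16)]
    have := hk1 s hs'
    have := mul_nonneg hC (sub_nonneg.2 hs.2.le)
    linarith
  have hmd : ∀ s ∈ Ioo (0 : ℝ) 1,
      s * deriv (profileMean φ) s = -sqProfile φ s / 16 - profileMean φ s := fun s hs => by
    rw [(h.hasDerivAt_profileMean hs.1.ne').deriv, mul_div_cancel₀ _ hs.1.ne']
  have hφd : ContDiffOn ℝ 1 φ disc := (h.contDiffOn.mono disc_subset_closedDisc).of_le (by norm_num)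
  have hkd : ContDiffOn ℝ 1 (sqProfile φ) (Ioo 0 1) := by
    have h1 : ContDiffOn ℝ 1 (fun s : ℝ => (Real.sqrt s, (0 : ℝ))) (Ioo 0 1) :=
      ContDiffOn.prodMk (contDiffOn_id.sqrt fun s hs => hs.1.ne') contDiffOn_const
    refine (hφd.comp h1 fun s hs => ?_).congr fun s hs => sqProfile_of_le_one hs.2.le
    change Real.sqrt s ^ 2 + 0 ^ 2 < 1
    rw [Real.sq_sqrt hs.1.le]
    linarith [hs.2]
  have hgd : ContDiffOn ℝ 1 (profileMean φ) (Ioo 0 1) := by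
    have h1 : ContDiff ℝ 1 (profilePrimitive φ) :=
      contDiff_one_iff_deriv.2 ⟨fun s => (h.hasDerivAt_primitive s).differentiableAt, by
        rw [funext fun s => (h.hasDerivAt_primitive s).deriv]
        exact h.continuous_sqProfile⟩
    refine (h1.neg.contDiffOn.div (contDiff_const.mul contDiff_id).contDiffOn
      fun s hs => ?_).congr fun s hs => if_neg hs.1.ne'
    have := hs.1
    simp [this.ne']
  have hbd : ∀ e : ℝ × ℝ, ‖e‖ ≤ 1 → ∀ p ∈ disc, |fderiv ℝ φ p e| ≤ 2 * C := by
    intro e he p hp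
    have h1 := hfd p (disc_subset_closedDisc hp)
    rw [fderivWithin_closedDisc φ hp] at h1
    have h2 := (fderiv ℝ φ p).le_opNorm e
    rw [Real.norm_eq_abs] at h2
    nlinarith [norm_nonneg e, norm_nonneg (fderiv ℝ φ p)]
  refine ⟨2 * C, ⟨fun p hp => h.eq_sqProfile (disc_subset_closedDisc hp), hφd, hkd,
    hbd (1, 0) (by simp [Prod.norm_def]), hbd (0, 1) (by simp [Prod.norm_def]),
    fun s hs => ?_, hgd, fun s hs => ?_, fun s hs => ?_, hmd, fun s hs => ?_, ?_⟩⟩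
  · have := hk1 s (Ico_subset_Icc_self hs)
    nlinarith [mul_nonneg hC (sub_nonneg.2 hs.2.le)]
  · have h1 := hg0 s (Ico_subset_Icc_self hs)
    have h2 := (hsq s (Ico_subset_Icc_self hs)).2
    have h3 := abs_sub_abs_le_abs_sub (profileMean φ s) (profileMean φ 0)
    nlinarith
  · have h1 := hg0 s (Ico_subset_Icc_self hs)
    nlinarith [mul_nonneg hC (Real.sqrt_nonneg s)]
  · exact sqrt_mul_defect_le hC hs (hdq s hs) (hdq1 s hs)
  -- A vanishing defect gives `s g' = 0`, so `g`, then `k`, then `φ` are constant and `Δφ = 0`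
  -- throughout the disc.
  · by_contra! hcon
    obtain ⟨p, hp, hlap⟩ := h.lap_ne
    have hgc : ∀ s ∈ Ioo (0 : ℝ) 1, ∀ t ∈ Ioo (0 : ℝ) 1, profileMean φ s = profileMean φ t := by
      intro s hs t ht
      refine isOpen_Ioo.is_const_of_deriv_eq_zero isPreconnected_Ioo
        (hgd.differentiableOn (by simp)) (fun r hr => ?_) hs ht
      have := hmd r hr
      rw [hcon r hr] at this
      exact (mul_eq_zero.1 this).resolve_left hr.1.ne'
    have hkc : ∀ s ∈ Ioo (0 : ℝ) 1, sqProfile φ s = sqProfile φ (1 / 2) := by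
      intro s hs
      have h12 : (1 / 2 : ℝ) ∈ Ioo (0 : ℝ) 1 := by norm_num
      linarith [hcon s hs, hcon _ h12, hgc s hs _ h12]
    have hkc0 : ∀ s ∈ Icc (0 : ℝ) 1, sqProfile φ s = sqProfile φ (1 / 2) := by
      rw [← closure_Ioo zero_ne_one]
      exact fun s hs => (EqOn.closure (f := sqProfile φ) (g := fun _ => sqProfile φ (1 / 2)) hkc
        h.continuous_sqProfile continuous_const) hs
    have hφc : ∀ p ∈ disc, φ p = sqProfile φ (1 / 2) := fun p hp => by
      rw [h.eq_sqProfile (disc_subset_closedDisc hp)]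
      exact hkc0 _ ⟨by positivity, le_of_lt hp⟩
    have hfz : ∀ p ∈ disc, fderiv ℝ φ p = 0 := fun p hp => by
      have : φ =ᶠ[𝓝 p] fun _ => sqProfile φ (1 / 2) := by
        filter_upwards [isOpen_disc.mem_nhds hp] with r hr using hφc r hr
      rw [this.fderiv_eq]
      simp
    have hz : ∀ e : ℝ × ℝ, fderiv ℝ (fun p => fderiv ℝ φ p e) p = 0 := fun e => by
      have : (fun p => fderiv ℝ φ p e) =ᶠ[𝓝 p] fun _ => 0 := by
        filter_upwards [isOpen_disc.mem_nhds hp] with r hr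
        rw [hfz r hr]; rfl
      rw [this.fderiv_eq]
      simp
    refine hlap ?_
    have h1 := hz (1, 0)
    have h2 := hz (0, 1)
    change fderiv ℝ (fun p => fderiv ℝ φ p (1, 0)) p (1, 0) +
      fderiv ℝ (fun p => fderiv ℝ φ p (0, 1)) p (0, 1) = 0
    rw [h1, h2]
    simp

end Profile

/-! ### Integration by parts in the cylinder -/

/-- The square of the distance from the axis. -/
def axisSq (x : V3) : ℝ := x 0 ^ 2 + x 1 ^ 2

/-- A function which vanishes to first order at the boundary of the cylinder. -/
def bdryFun (x : V3) : ℝ := (1 - axisSq x) * (x 2 * (1 - x 2))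

/-- The cylinder without its axis. -/
def puncturedCylinder : Set V3 := {x | x ∈ cylinder ∧ 0 < axisSq x}

theorem contDiff_axisSq {n : WithTop ℕ∞} : ContDiff ℝ n axisSq := by
  unfold axisSq; fun_prop

theorem continuous_axisSq : Continuous axisSq := contDiff_axisSq.continuous (n := 0)

theorem contDiff_bdryFun {n : WithTop ℕ∞} : ContDiff ℝ n bdryFun := by
  unfold bdryFun axisSq; fun_prop

theorem axisSq_nonneg (x : V3) : 0 ≤ axisSq x := by unfold axisSq; positivity

theorem isOpen_cylinder : IsOpen cylinder :=
  (isOpen_lt continuous_axisSq continuous_const).inter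
    ((isOpen_lt continuous_const (continuous_apply 2)).inter
      (isOpen_lt (continuous_apply 2) continuous_const))

theorem isOpen_puncturedCylinder : IsOpen puncturedCylinder :=
  isOpen_cylinder.inter (isOpen_lt continuous_const continuous_axisSq)

theorem axisSq_lt_one {x : V3} (hx : x ∈ cylinder) : axisSq x < 1 := hx.1

theorem mk_mem_disc {x : V3} (hx : x ∈ cylinder) : (x 0, x 1) ∈ disc := hx.1

/-- The closed cylinder. -/
def closedCylinder : Set V3 := {x | axisSq x ≤ 1 ∧ 0 ≤ x 2 ∧ x 2 ≤ 1}

theorem isCompact_closedCylinder : IsCompact closedCylinder := by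
  refine Metric.isCompact_of_isClosed_isBounded
    ((isClosed_le continuous_axisSq continuous_const).inter
    ((isClosed_le continuous_const (continuous_apply 2)).inter (isClosed_le (continuous_apply 2)
      continuous_const))) ((Metric.isBounded_closedBall (x := (0 : V3)) (r := 1)).subset
      fun x hx => ?_)
  obtain ⟨h1, h2, h3⟩ := hx
  unfold axisSq at h1
  rw [mem_closedBall_zero_iff, pi_norm_le_iff_of_nonneg zero_le_one]
  intro i
  rw [Real.norm_eq_abs, abs_le_one_iff_mul_self_le_one]
  fin_cases i <;> simp <;> nlinarith [sq_nonneg (x 0), sq_nonneg (x 1)]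

theorem cylinder_subset_closedCylinder : cylinder ⊆ closedCylinder := by
  rintro x ⟨h1, h2, h3⟩
  exact ⟨h1.le, h2.le, h3.le⟩

instance isFiniteMeasure_cylinder : IsFiniteMeasure (volume.restrict cylinder) :=
  ⟨by
    rw [Measure.restrict_apply_univ]
    exact (measure_mono cylinder_subset_closedCylinder).trans_lt
      isCompact_closedCylinder.measure_lt_top⟩

theorem volume_cylinder_diff_punctured : volume (cylinder \ puncturedCylinder) = 0 := by
  have h0 : volume {x : V3 | x 0 = 0} = 0 :=
    Measure.pi_hyperplane (fun _ : Fin 3 => (volume : Measure ℝ)) 0 0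
  refine measure_mono_null (fun x hx => ?_) h0
  have h1 : ¬ 0 < axisSq x := fun h => hx.2 ⟨hx.1, h⟩
  unfold axisSq at h1
  change x 0 = 0
  nlinarith [sq_nonneg (x 0), sq_nonneg (x 1)]

theorem ae_mem_puncturedCylinder : ∀ᵐ x ∂volume.restrict cylinder, x ∈ puncturedCylinder := by
  rw [ae_restrict_iff' isOpen_cylinder.measurableSet, ae_iff]
  convert volume_cylinder_diff_punctured using 2
  ext x; simp

theorem bdryFun_pos {x : V3} (hx : x ∈ cylinder) : 0 < bdryFun x :=
  mul_pos (sub_pos.2 hx.1) (mul_pos hx.2.1 (sub_pos.2 hx.2.2))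

theorem hasFDerivAt_coord (i : Fin 3) (x : V3) :
    HasFDerivAt (fun y : V3 => y i) (ContinuousLinearMap.proj (R := ℝ) (φ := fun _ => ℝ) i) x :=
  hasFDerivAt_apply i x

theorem hasFDerivAt_axisSq (x : V3) : HasFDerivAt axisSq
    ((2 * x 0) • ContinuousLinearMap.proj (R := ℝ) (φ := fun _ => ℝ) 0 +
      (2 * x 1) • ContinuousLinearMap.proj (R := ℝ) (φ := fun _ => ℝ) 1) x := by
  have := ((hasFDerivAt_coord 0 x).pow 2).add ((hasFDerivAt_coord 1 x).pow 2)
  refine this.congr_fderiv ?_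
  ext1 e
  simp

theorem fderiv_bdryFun (x e : V3) : fderiv ℝ bdryFun x e =
    -(2 * x 0 * e 0 + 2 * x 1 * e 1) * (x 2 * (1 - x 2)) +
      (1 - axisSq x) * ((1 - 2 * x 2) * e 2) := by
  have := ((hasFDerivAt_axisSq x).const_sub 1).mul
    ((hasFDerivAt_coord 2 x).mul ((hasFDerivAt_coord 2 x).const_sub 1))
  rw [show fderiv ℝ bdryFun x = _ from this.fderiv]
  simp
  ring

theorem fderiv_axisSq_mul_bdryFun (x e : V3) : fderiv ℝ (fun x => axisSq x * bdryFun x) x e =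
    (1 - 2 * axisSq x) * (2 * x 0 * e 0 + 2 * x 1 * e 1) * (x 2 * (1 - x 2)) +
      axisSq x * (1 - axisSq x) * ((1 - 2 * x 2) * e 2) := by
  have h := (hasFDerivAt_axisSq x).mul
    ((contDiff_bdryFun (n := 1)).differentiable (by simp) x).hasFDerivAt
  rw [show fderiv ℝ (fun x => axisSq x * bdryFun x) x = _ from h.fderiv]
  simp only [add_apply, smul_apply, smul_eq_mul, fderiv_bdryFun, ContinuousLinearMap.proj_apply]
  unfold bdryFun
  ring

theorem isCompact_le_bdryFun {ε : ℝ} (hε : 0 < ε) :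
    IsCompact {x | x ∈ cylinder ∧ ε ≤ bdryFun x} := by
  have : {x | x ∈ cylinder ∧ ε ≤ bdryFun x} = closedCylinder ∩ {x | ε ≤ bdryFun x} := by
    ext x
    refine ⟨fun h => ⟨cylinder_subset_closedCylinder h.1, h.2⟩, fun h => ⟨?_, h.2⟩⟩
    obtain ⟨⟨h1, h2, h3⟩, h4⟩ := h
    have h4 : ε ≤ (1 - axisSq x) * (x 2 * (1 - x 2)) := h4
    refine ⟨lt_of_le_of_ne h1 fun he => ?_, lt_of_le_of_ne h2 fun he => ?_,
      lt_of_le_of_ne h3 fun he => ?_⟩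
    · rw [show axisSq x = 1 from he] at h4
      linarith
    · rw [← he] at h4
      linarith
    · rw [he] at h4
      linarith
  rw [this]
  exact isCompact_closedCylinder.inter_right
    (isClosed_le continuous_const (contDiff_bdryFun (n := 0)).continuous)

theorem isCompact_le_axisSq_mul_bdryFun {ε : ℝ} (hε : 0 < ε) :
    IsCompact {x | x ∈ puncturedCylinder ∧ ε ≤ axisSq x * bdryFun x} := by
  have : {x | x ∈ puncturedCylinder ∧ ε ≤ axisSq x * bdryFun x} =
      {x | x ∈ cylinder ∧ ε ≤ bdryFun x} ∩ {x | ε ≤ axisSq x * bdryFun x} := by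
    ext x
    constructor
    · rintro ⟨⟨h1, h2⟩, h3⟩
      refine ⟨⟨h1, h3.trans ?_⟩, h3⟩
      have := bdryFun_pos h1
      nlinarith [axisSq_lt_one h1]
    · rintro ⟨⟨h1, -⟩, h3⟩
      refine ⟨⟨h1, lt_of_le_of_ne (axisSq_nonneg x) fun h => ?_⟩, h3⟩
      have h3 : ε ≤ axisSq x * bdryFun x := h3
      rw [← h, zero_mul] at h3
      linarith
  rw [this]
  exact (isCompact_le_bdryFun hε).inter_right (isClosed_le continuous_const
    (continuous_axisSq.mul (contDiff_bdryFun (n := 0)).continuous))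

section Parts

variable {v : V3 → ℝ} {g : Fin 3 → V3 → ℝ} {D : V3 → ℝ} {C : ℝ}

/-- The cutoff uses `axisSq * bdryFun`, which vanishes on the axis too, because the shear stresses
are only known to be bounded there. For a field without axial component, tangency reduces to a bound
on its radial part. -/
theorem integral_mul_eq_of_punctured (hv : IntegrableOn v cylinder)
    (hg : ∀ j, IntegrableOn (g j) cylinder) (hw : ∀ j, IsWeakPartial cylinder j v (g j))
    {F₀ F₁ : V3 → ℝ} (h₀ : ContDiffOn ℝ 1 F₀ puncturedCylinder)
    (h₁ : ContDiffOn ℝ 1 F₁ puncturedCylinder) (hb₀ : ∀ x ∈ puncturedCylinder, |F₀ x| ≤ C)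
    (hb₁ : ∀ x ∈ puncturedCylinder, |F₁ x| ≤ C)
    (hD : ∀ x ∈ puncturedCylinder,
      fderiv ℝ F₀ x (Pi.single 0 1) + fderiv ℝ F₁ x (Pi.single 1 1) = D x)
    (hDC : ∀ x ∈ puncturedCylinder, |D x| ≤ C)
    (ht : ∀ x ∈ puncturedCylinder,
      |x 0 * F₀ x + x 1 * F₁ x| ≤ C * (axisSq x * (1 - axisSq x))) :
    ∫ x in cylinder, (g 0 x * F₀ x + g 1 x * F₁ x) = -∫ x in cylinder, v x * D x := by
  have hle : ∀ x ∈ puncturedCylinder, C ≤ 2 * C ∧ 0 ≤ C := fun x hx => by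
    have := (abs_nonneg _).trans (hDC x hx)
    constructor <;> linarith
  have := integral_sum_mul_eq_neg_integral_mul_div isOpen_cylinder isOpen_puncturedCylinder
    (fun x hx => hx.1) volume_cylinder_diff_punctured
    (d := fun x => axisSq x * bdryFun x) (contDiff_axisSq.mul contDiff_bdryFun)
    (fun x hx => mul_pos hx.2 (bdryFun_pos hx.1))
    (fun ε hε => isCompact_le_axisSq_mul_bdryFun hε) hv hg hw
    -- The factor `2` comes from the gradient `(2x, 2y)` of `axisSq`.
    (F := ![F₀, F₁, fun _ => 0]) (D := D) (C := 2 * C)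
    (by
      intro j
      fin_cases j
      · exact h₀
      · exact h₁
      · exact contDiffOn_const)
    (by
      intro j x hx
      have := hle x hx
      fin_cases j
      · exact (hb₀ x hx).trans this.1
      · exact (hb₁ x hx).trans this.1
      · simpa using this.2)
    (fun x hx => by simpa [Fin.sum_univ_three] using hD x hx)
    (fun x hx => (hDC x hx).trans (hle x hx).1)
    (fun x hx => by
      have hz : 0 < x 2 * (1 - x 2) := mul_pos hx.1.2.1 (sub_pos.2 hx.1.2.2)
      have h1 : ∑ j : Fin 3, fderiv ℝ (fun x => axisSq x * bdryFun x) x (Pi.single j 1) *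
          (![F₀, F₁, fun _ => 0] : Fin 3 → V3 → ℝ) j x =
          (1 - 2 * axisSq x) * (x 0 * F₀ x + x 1 * F₁ x) * (2 * (x 2 * (1 - x 2))) := by
        rw [Fin.sum_univ_three]
        simp [fderiv_axisSq_mul_bdryFun]
        ring
      rw [h1, abs_mul, abs_mul, abs_of_pos (by linarith : 0 < 2 * (x 2 * (1 - x 2)))]
      have h2 : |1 - 2 * axisSq x| ≤ 1 := by
        rw [abs_le]; constructor <;> linarith [axisSq_lt_one hx.1, hx.2]
      have h3 := mul_le_mul h2 (ht x hx) (abs_nonneg _) zero_le_one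
      calc _ ≤ 1 * (C * (axisSq x * (1 - axisSq x))) * (2 * (x 2 * (1 - x 2))) :=
            mul_le_mul_of_nonneg_right h3 (by linarith)
        _ = _ := by unfold bdryFun; ring)
  simpa [Fin.sum_univ_three] using this

/-- The case of the field `F eᵢ`, regular across the axis, so that the cutoff only has to remove the
boundary. -/
theorem integral_mul_eq_of_tangential (hv : IntegrableOn v cylinder)
    (hg : ∀ j, IntegrableOn (g j) cylinder) (hw : ∀ j, IsWeakPartial cylinder j v (g j))
    (i : Fin 3) {F : V3 → ℝ} (hF : ContDiffOn ℝ 1 F cylinder) (hb : ∀ x ∈ cylinder, |F x| ≤ C)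
    (hD : ∀ x ∈ cylinder, fderiv ℝ F x (Pi.single i 1) = D x) (hDC : ∀ x ∈ cylinder, |D x| ≤ C)
    (ht : ∀ x ∈ cylinder, |fderiv ℝ bdryFun x (Pi.single i 1) * F x| ≤ C * bdryFun x) :
    ∫ x in cylinder, g i x * F x = -∫ x in cylinder, v x * D x := by
  have hsum : ∀ f : Fin 3 → ℝ, (∀ j ≠ i, f j = 0) → ∑ j, f j = f i := fun f hf =>
    Finset.sum_eq_single i (fun j _ hj => hf j hj) (fun h => absurd (Finset.mem_univ i) h)
  have := integral_sum_mul_eq_neg_integral_mul_div isOpen_cylinder isOpen_cylinder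
    subset_rfl (by simp) (d := bdryFun) contDiff_bdryFun
    (fun x hx => bdryFun_pos hx) (fun ε hε => isCompact_le_bdryFun hε) hv hg hw
    (F := fun j x => if j = i then F x else 0) (D := D) (C := C)
    (by
      intro j
      by_cases hj : j = i
      · simpa [hj] using hF
      · simpa [hj] using contDiffOn_const)
    (by
      intro j x hx
      by_cases hj : j = i
      · simpa [hj] using hb x hx
      · simpa [hj] using (abs_nonneg _).trans (hb x hx))
    (fun x hx => by
      rw [hsum _ fun j hj => by simp [hj]]
      simpa using hD x hx) hDC
    (fun x hx => by
      rw [hsum _ fun j hj => by simp [hj]]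
      simpa using ht x hx)
  rw [← this]
  congr 1
  ext x
  rw [hsum _ fun j hj => by simp [hj]]
  simp

end Parts

/-! ### The stress fields -/

/-- The radial factor of the shear stress. -/
def shearFactor (k g : ℝ → ℝ) (s : ℝ) : ℝ := 16 * (-k s / 16 - g s) / s

/-- The shear stress component `P(s) (x² - y²)`. -/
def shearDiff (k g : ℝ → ℝ) (x : V3) : ℝ := shearFactor k g (axisSq x) * (x 0 ^ 2 - x 1 ^ 2)

/-- The shear stress component `2 P(s) x y`. -/
def shearProd (k g : ℝ → ℝ) (x : V3) : ℝ := shearFactor k g (axisSq x) * (2 * x 0 * x 1)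

theorem axisSq_mem_Ioo {x : V3} (hx : x ∈ puncturedCylinder) : axisSq x ∈ Ioo (0 : ℝ) 1 :=
  ⟨hx.2, axisSq_lt_one hx.1⟩

theorem axisSq_mem_Ico {x : V3} (hx : x ∈ cylinder) : axisSq x ∈ Ico (0 : ℝ) 1 :=
  ⟨axisSq_nonneg x, axisSq_lt_one hx⟩

theorem hasFDerivAt_sq_add_sq (p : ℝ × ℝ) :
    HasFDerivAt (fun p : ℝ × ℝ => p.1 ^ 2 + p.2 ^ 2)
      ((2 * p.1) • ContinuousLinearMap.fst ℝ ℝ ℝ + (2 * p.2) • ContinuousLinearMap.snd ℝ ℝ ℝ)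
      p := by
  have := ((hasFDerivAt_fst (𝕜 := ℝ) (p := p)).pow 2).add
    ((hasFDerivAt_snd (𝕜 := ℝ) (p := p)).pow 2)
  refine this.congr_fderiv ?_
  ext <;> simp

section Profile

variable {φ : ℝ × ℝ → ℝ} {k g : ℝ → ℝ} {C : ℝ}

theorem IsProfile.nonneg (h : IsProfile φ k g C) : 0 ≤ C :=
  (abs_nonneg _).trans (h.abs_dx_le 0 (by simp [disc]))

theorem IsProfile.hasDerivAt (h : IsProfile φ k g C) {s : ℝ} (hs : s ∈ Ioo (0 : ℝ) 1) :
    HasDerivAt k (deriv k s) s :=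
  ((h.contDiffOn.contDiffAt (Ioo_mem_nhds hs.1 hs.2)).differentiableAt (by simp)).hasDerivAt

/-- The shear factor is `16 g'`, which ties the shear stress to the derivatives of `g(s) x` and
`g(s) y`. -/
theorem IsProfile.hasDerivAt_avg (h : IsProfile φ k g C) {s : ℝ} (hs : s ∈ Ioo (0 : ℝ) 1) :
    HasDerivAt g (shearFactor k g s / 16) s := by
  have h1 := ((h.contDiffOn_avg.contDiffAt (Ioo_mem_nhds hs.1 hs.2)).differentiableAt
    (by simp)).hasDerivAt
  have h2 : deriv g s = shearFactor k g s / 16 := by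
    have := hs.1
    rw [shearFactor, ← h.mul_deriv_avg s hs]
    field_simp
  rwa [h2] at h1

/-- For the shear factor `P`, differentiating `sP = -k - 16g` with `16g' = P` gives `sP' + 2P =
-k'`. This equation makes the divergence of the shear stress a multiple of `∇φ`. -/
theorem IsProfile.hasDerivAt_shearFactor (h : IsProfile φ k g C) {s : ℝ}
    (hs : s ∈ Ioo (0 : ℝ) 1) :
    HasDerivAt (shearFactor k g) ((-deriv k s - 2 * shearFactor k g s) / s) s := by
  have h1 := ((((h.hasDerivAt hs).neg.div_const 16).sub (h.hasDerivAt_avg hs)).const_mul 16).div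
    (hasDerivAt_id s) hs.1.ne'
  refine h1.congr_deriv ?_
  have := hs.1
  simp only [shearFactor, id, Pi.sub_apply, Pi.neg_apply]
  field_simp
  ring

theorem IsProfile.contDiffOn_shearFactor (h : IsProfile φ k g C) :
    ContDiffOn ℝ 1 (shearFactor k g) (Ioo 0 1) :=
  (contDiffOn_const.mul ((h.contDiffOn.neg.div_const 16).sub h.contDiffOn_avg)).div contDiffOn_id
    fun _ hs => hs.1.ne'

theorem IsProfile.fderiv_eq (h : IsProfile φ k g C) {p : ℝ × ℝ} (hp : p ∈ disc)
    (h0 : 0 < p.1 ^ 2 + p.2 ^ 2) (e : ℝ × ℝ) :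
    fderiv ℝ φ p e = deriv k (p.1 ^ 2 + p.2 ^ 2) * (2 * p.1 * e.1 + 2 * p.2 * e.2) := by
  have he : φ =ᶠ[𝓝 p] k ∘ fun p : ℝ × ℝ => p.1 ^ 2 + p.2 ^ 2 := by
    filter_upwards [isOpen_disc.mem_nhds hp] with q hq using h.eq_profile q hq
  have h1 := (h.hasDerivAt (s := p.1 ^ 2 + p.2 ^ 2) ⟨h0, hp⟩).comp_hasFDerivAt p
    (hasFDerivAt_sq_add_sq p)
  rw [he.fderiv_eq, h1.fderiv]
  simp [mul_add]

theorem IsProfile.dx_eq (h : IsProfile φ k g C) {x : V3} (hx : x ∈ puncturedCylinder) :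
    dx φ (x 0, x 1) = 2 * x 0 * deriv k (axisSq x) := by
  rw [dx, h.fderiv_eq (mk_mem_disc hx.1) hx.2, axisSq]
  simp; ring

theorem IsProfile.dy_eq (h : IsProfile φ k g C) {x : V3} (hx : x ∈ puncturedCylinder) :
    dy φ (x 0, x 1) = 2 * x 1 * deriv k (axisSq x) := by
  rw [dy, h.fderiv_eq (mk_mem_disc hx.1) hx.2, axisSq]
  simp; ring

theorem IsProfile.abs_mul_shearFactor_le (h : IsProfile φ k g C) {s : ℝ} (hs : s ∈ Ioo (0 : ℝ) 1) :
    |s * shearFactor k g s| ≤ 16 * C := by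
  have h1 := h.abs_defect_le s hs
  have h2 := Real.mul_self_sqrt hs.1.le
  have h3 : 0 < Real.sqrt s := Real.sqrt_pos.2 hs.1
  have h4 : Real.sqrt s ≤ 1 := Real.sqrt_le_one.2 hs.2.le
  have h5 : s * shearFactor k g s = 16 * (-k s / 16 - g s) := by
    rw [shearFactor, mul_div_cancel₀ _ hs.1.ne']
  rw [h5, abs_mul, abs_of_pos (by norm_num : (0 : ℝ) < 16)]
  refine mul_le_mul_of_nonneg_left (le_of_mul_le_mul_left (h1.trans ?_) h3) (by norm_num)
  have h6 := h.nonneg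
  have h7 : s * (1 - s) ≤ Real.sqrt s := by nlinarith [hs.1, hs.2]
  nlinarith

theorem IsProfile.abs_shearFactor_mul_le (h : IsProfile φ k g C) {x : V3}
    (hx : x ∈ puncturedCylinder) {t : ℝ} (ht : |t| ≤ axisSq x) :
    |shearFactor k g (axisSq x) * t| ≤ 16 * C := by
  refine le_trans ?_ (h.abs_mul_shearFactor_le (axisSq_mem_Ioo hx))
  rw [abs_mul, abs_mul, mul_comm, abs_of_pos hx.2]
  exact mul_le_mul_of_nonneg_right ht (abs_nonneg _)

theorem abs_sq_sub_sq_le (x : V3) : |x 0 ^ 2 - x 1 ^ 2| ≤ axisSq x := by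
  rw [abs_le, axisSq]; constructor <;> nlinarith [sq_nonneg (x 0), sq_nonneg (x 1)]

theorem abs_two_mul_mul_le (x : V3) : |2 * x 0 * x 1| ≤ axisSq x := by
  rw [abs_le, axisSq]; constructor <;> nlinarith [sq_nonneg (x 0 - x 1), sq_nonneg (x 0 + x 1)]

theorem IsProfile.abs_shearDiff_le (h : IsProfile φ k g C) {x : V3} (hx : x ∈ puncturedCylinder) :
    |shearDiff k g x| ≤ 16 * C := h.abs_shearFactor_mul_le hx (abs_sq_sub_sq_le x)

theorem IsProfile.abs_shearProd_le (h : IsProfile φ k g C) {x : V3} (hx : x ∈ puncturedCylinder) :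
    |shearProd k g x| ≤ 16 * C := h.abs_shearFactor_mul_le hx (abs_two_mul_mul_le x)

theorem IsProfile.contDiffOn_comp_axisSq (h : IsProfile φ k g C) :
    ContDiffOn ℝ 1 (fun x => shearFactor k g (axisSq x)) puncturedCylinder :=
  h.contDiffOn_shearFactor.comp contDiff_axisSq.contDiffOn fun _ hx => axisSq_mem_Ioo hx

theorem IsProfile.contDiffOn_shearDiff (h : IsProfile φ k g C) :
    ContDiffOn ℝ 1 (shearDiff k g) puncturedCylinder :=
  h.contDiffOn_comp_axisSq.mul (by fun_prop)

theorem IsProfile.contDiffOn_shearProd (h : IsProfile φ k g C) :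
    ContDiffOn ℝ 1 (shearProd k g) puncturedCylinder :=
  h.contDiffOn_comp_axisSq.mul (by fun_prop)

theorem IsProfile.hasFDerivAt_shearFactor (h : IsProfile φ k g C) {x : V3}
    (hx : x ∈ puncturedCylinder) :
    HasFDerivAt (fun x => shearFactor k g (axisSq x))
      (((-deriv k (axisSq x) - 2 * shearFactor k g (axisSq x)) / axisSq x) •
        ((2 * x 0) • ContinuousLinearMap.proj (R := ℝ) (φ := fun _ => ℝ) 0 +
          (2 * x 1) • ContinuousLinearMap.proj (R := ℝ) (φ := fun _ => ℝ) 1)) x :=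
  (h.hasDerivAt_shearFactor (axisSq_mem_Ioo hx)).comp_hasFDerivAt x (hasFDerivAt_axisSq x)

theorem IsProfile.fderiv_shearDiff (h : IsProfile φ k g C) {x : V3} (hx : x ∈ puncturedCylinder)
    (e : V3) : fderiv ℝ (shearDiff k g) x e =
      ((-deriv k (axisSq x) - 2 * shearFactor k g (axisSq x)) / axisSq x) *
        (2 * x 0 * e 0 + 2 * x 1 * e 1) * (x 0 ^ 2 - x 1 ^ 2) +
      shearFactor k g (axisSq x) * (2 * x 0 * e 0 - 2 * x 1 * e 1) := by
  have h1 := (h.hasFDerivAt_shearFactor hx).mul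
    (((hasFDerivAt_coord 0 x).pow 2).sub ((hasFDerivAt_coord 1 x).pow 2))
  rw [show fderiv ℝ (shearDiff k g) x = _ from h1.fderiv]
  simp
  ring

theorem IsProfile.fderiv_shearProd (h : IsProfile φ k g C) {x : V3} (hx : x ∈ puncturedCylinder)
    (e : V3) : fderiv ℝ (shearProd k g) x e =
      ((-deriv k (axisSq x) - 2 * shearFactor k g (axisSq x)) / axisSq x) *
        (2 * x 0 * e 0 + 2 * x 1 * e 1) * (2 * x 0 * x 1) +
      shearFactor k g (axisSq x) * (2 * x 1 * e 0 + 2 * x 0 * e 1) := by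
  have h1 := (h.hasFDerivAt_shearFactor hx).mul
    (((hasFDerivAt_coord 0 x).const_mul 2).mul (hasFDerivAt_coord 1 x))
  rw [show fderiv ℝ (shearProd k g) x = _ from h1.fderiv]
  simp
  ring

variable {v : V3 → ℝ} {G : Fin 3 → V3 → ℝ}

/-- The radial component of a shear stress row is a coordinate times `sP`, and `sP` is 16 times the
defect. Since `|t| ≤ √s`, the weighted defect bound is exactly what is needed. -/
theorem IsProfile.abs_coord_mul_shearFactor_le (h : IsProfile φ k g C) {x : V3}
    (hx : x ∈ puncturedCylinder) {t : ℝ} (ht : t ^ 2 ≤ axisSq x) :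
    |t * (axisSq x * shearFactor k g (axisSq x))| ≤ 16 * C * (axisSq x * (1 - axisSq x)) := by
  have h1 := h.abs_defect_le _ (axisSq_mem_Ioo hx)
  have h5 : axisSq x * shearFactor k g (axisSq x) = 16 * (-k (axisSq x) / 16 - g (axisSq x)) := by
    rw [shearFactor, mul_div_cancel₀ _ hx.2.ne']
  rw [h5, abs_mul, abs_mul, abs_of_pos (by norm_num : (0 : ℝ) < 16)]
  have h2 : |t| ≤ Real.sqrt (axisSq x) := Real.abs_le_sqrt ht
  have h3 := mul_le_mul_of_nonneg_right h2 (abs_nonneg (-k (axisSq x) / 16 - g (axisSq x)))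
  linarith

/-- The trace-free matrix `S` with rows `(d, p)` and `(p, -d)`, where `d` and `p` are `shearDiff`
and `shearProd`, has divergence `-∇φ`. Here minus its second row is used, with divergence `φ_y` and
radial part `-y s P`. -/
theorem IsProfile.integral_shear_dy (h : IsProfile φ k g C) (hv : IntegrableOn v cylinder)
    (hG : ∀ j, IntegrableOn (G j) cylinder) (hw : ∀ j, IsWeakPartial cylinder j v (G j)) :
    ∫ x in cylinder, (G 0 x * -shearProd k g x + G 1 x * shearDiff k g x) =
      -∫ x in cylinder, v x * dy φ (x 0, x 1) := by
  have hC := h.nonneg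
  refine integral_mul_eq_of_punctured (C := 16 * C) hv hG hw h.contDiffOn_shearProd.neg
    h.contDiffOn_shearDiff (fun x hx => by rw [abs_neg]; exact h.abs_shearProd_le hx)
    (fun x hx => h.abs_shearDiff_le hx) (fun x hx => ?_)
    (fun x hx => (h.abs_dy_le _ (mk_mem_disc hx.1)).trans (by linarith)) (fun x hx => ?_)
  · rw [fderiv_fun_neg, neg_apply, h.fderiv_shearProd hx, h.fderiv_shearDiff hx, h.dy_eq hx]
    have hs := hx.2.ne'
    simp
    field_simp
    unfold axisSq
    ring
  · have e : x 0 * -shearProd k g x + x 1 * shearDiff k g x =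
        -x 1 * (axisSq x * shearFactor k g (axisSq x)) := by
      unfold shearProd shearDiff axisSq; ring
    rw [e]
    exact h.abs_coord_mul_shearFactor_le hx (by unfold axisSq; nlinarith [sq_nonneg (x 0)])

/-- The first row of the same matrix, with divergence `-φ_x` and radial part `x s P`. -/
theorem IsProfile.integral_shear_dx (h : IsProfile φ k g C) (hv : IntegrableOn v cylinder)
    (hG : ∀ j, IntegrableOn (G j) cylinder) (hw : ∀ j, IsWeakPartial cylinder j v (G j)) :
    ∫ x in cylinder, (G 0 x * shearDiff k g x + G 1 x * shearProd k g x) =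
      ∫ x in cylinder, v x * dx φ (x 0, x 1) := by
  have hC := h.nonneg
  have := integral_mul_eq_of_punctured (C := 16 * C) (D := fun x => -dx φ (x 0, x 1)) hv hG hw
    h.contDiffOn_shearDiff h.contDiffOn_shearProd (fun x hx => h.abs_shearDiff_le hx)
    (fun x hx => h.abs_shearProd_le hx) (fun x hx => ?_)
    (fun x hx => by
      rw [abs_neg]; exact (h.abs_dx_le _ (mk_mem_disc hx.1)).trans (by linarith)) (fun x hx => ?_)
  · rw [this, ← integral_neg]
    congr 1; ext x; ring
  · rw [h.fderiv_shearProd hx, h.fderiv_shearDiff hx, h.dx_eq hx]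
    have hs := hx.2.ne'
    simp
    field_simp
    unfold axisSq
    ring
  · have e : x 0 * shearDiff k g x + x 1 * shearProd k g x =
        x 0 * (axisSq x * shearFactor k g (axisSq x)) := by
      unfold shearProd shearDiff axisSq; ring
    rw [e]
    exact h.abs_coord_mul_shearFactor_le hx (by unfold axisSq; nlinarith [sq_nonneg (x 1)])

/-- The potential as a function on the cylinder. -/
def liftPotential (φ : ℝ × ℝ → ℝ) (x : V3) : ℝ := φ (x 0, x 1)

theorem IsProfile.hasFDerivAt_lift (h : IsProfile φ k g C) {x : V3} (hx : x ∈ cylinder) :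
    HasFDerivAt (liftPotential φ) ((fderiv ℝ φ (x 0, x 1)).comp
      ((ContinuousLinearMap.proj (R := ℝ) (φ := fun _ => ℝ) 0).prod
        (ContinuousLinearMap.proj (R := ℝ) (φ := fun _ => ℝ) 1))) x :=
  (((h.contDiffOn_potential.contDiffAt (isOpen_disc.mem_nhds (mk_mem_disc hx))).differentiableAt
    (by simp)).hasFDerivAt (x := (x 0, x 1))).comp x
    ((hasFDerivAt_coord 0 x).prodMk (hasFDerivAt_coord 1 x))

theorem IsProfile.contDiffOn_lift (h : IsProfile φ k g C) :
    ContDiffOn ℝ 1 (liftPotential φ) cylinder :=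
  h.contDiffOn_potential.comp (f := fun x : V3 => (x 0, x 1)) (by fun_prop)
    fun _ hx => mk_mem_disc hx

theorem IsProfile.lift_eq (h : IsProfile φ k g C) {x : V3} (hx : x ∈ cylinder) :
    liftPotential φ x = k (axisSq x) := h.eq_profile _ (mk_mem_disc hx)

theorem IsProfile.abs_lift_le (h : IsProfile φ k g C) {x : V3} (hx : x ∈ cylinder) :
    |liftPotential φ x| ≤ C * (1 - axisSq x) := by
  rw [h.lift_eq hx]
  exact h.abs_le _ (axisSq_mem_Ico hx)

/-- The field `φ eᵢ` has no boundary term: `φ` is `O(1 - s)` at the lateral wall, and a planar `eᵢ`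
is tangential to top and bottom. -/
theorem IsProfile.integral_lift (h : IsProfile φ k g C) (hv : IntegrableOn v cylinder)
    (hG : ∀ j, IntegrableOn (G j) cylinder) (hw : ∀ j, IsWeakPartial cylinder j v (G j))
    {i : Fin 3} (hi : i ≠ 2) :
    ∫ x in cylinder, G i x * liftPotential φ x =
      -∫ x in cylinder, v x * fderiv ℝ φ (x 0, x 1) ((Pi.single i 1 : V3) 0, (Pi.single i 1 : V3) 1)
      := by
  have hC := h.nonneg
  refine integral_mul_eq_of_tangential (C := 2 * C) hv hG hw i h.contDiffOn_lift
    (fun x hx => ?_) (fun x hx => ?_) (fun x hx => ?_) (fun x hx => ?_)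
  · have := h.abs_lift_le hx
    nlinarith [axisSq_nonneg x]
  · rw [(h.hasFDerivAt_lift hx).fderiv]
    rfl
  · have h1 := h.abs_dx_le _ (mk_mem_disc hx)
    have h2 := h.abs_dy_le _ (mk_mem_disc hx)
    fin_cases i
    · simpa [dx] using h1.trans (by linarith)
    · simpa [dy] using h2.trans (by linarith)
    · exact absurd rfl hi
  · have hz : 0 < x 2 * (1 - x 2) := mul_pos hx.2.1 (sub_pos.2 hx.2.2)
    have h0 : |fderiv ℝ bdryFun x (Pi.single i 1)| ≤ 2 * (x 2 * (1 - x 2)) := by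
      have ha : ∀ t : ℝ, t ^ 2 ≤ axisSq x → |-(2 * t) * (x 2 * (1 - x 2))| ≤
          2 * (x 2 * (1 - x 2)) := by
        intro t ht
        rw [abs_mul, abs_of_pos hz, abs_neg]
        refine mul_le_mul_of_nonneg_right ?_ hz.le
        rw [_root_.abs_le]
        constructor <;> nlinarith [axisSq_lt_one hx]
      rw [fderiv_bdryFun]
      fin_cases i
      · simpa using ha (x 0) (by unfold axisSq; nlinarith [sq_nonneg (x 1)])
      · simpa using ha (x 1) (by unfold axisSq; nlinarith [sq_nonneg (x 0)])
      · exact absurd rfl hi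
    rw [abs_mul]
    calc _ ≤ 2 * (x 2 * (1 - x 2)) * (C * (1 - axisSq x)) :=
          mul_le_mul h0 (h.abs_lift_le hx) (abs_nonneg _) (by linarith)
      _ = _ := by unfold bdryFun; ring

theorem IsProfile.integral_lift_dx (h : IsProfile φ k g C) (hv : IntegrableOn v cylinder)
    (hG : ∀ j, IntegrableOn (G j) cylinder) (hw : ∀ j, IsWeakPartial cylinder j v (G j)) :
    ∫ x in cylinder, G 0 x * liftPotential φ x = -∫ x in cylinder, v x * dx φ (x 0, x 1) := by
  simpa [dx] using h.integral_lift hv hG hw (i := 0) (by decide)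

theorem IsProfile.integral_lift_dy (h : IsProfile φ k g C) (hv : IntegrableOn v cylinder)
    (hG : ∀ j, IntegrableOn (G j) cylinder) (hw : ∀ j, IsWeakPartial cylinder j v (G j)) :
    ∫ x in cylinder, G 1 x * liftPotential φ x = -∫ x in cylinder, v x * dy φ (x 0, x 1) := by
  simpa [dy] using h.integral_lift hv hG hw (i := 1) (by decide)

end Profile

/-! ### The axial load -/

section Axial

variable {ψ : ℝ → ℝ} {v : V3 → ℝ} {G : Fin 3 → V3 → ℝ}

/-- The primitive of the axial load. -/
def axialPrimitive (ψ : ℝ → ℝ) (z : ℝ) : ℝ := ∫ t in (0 : ℝ)..z, ψ t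

theorem hasDerivAt_axialPrimitive (hψ : ContinuousOn ψ (Icc 0 1)) {z : ℝ} (hz : z ∈ Ioo (0 : ℝ) 1) :
    HasDerivAt (axialPrimitive ψ) (ψ z) z := by
  have hz' := Icc_mem_nhds hz.1 hz.2
  refine intervalIntegral.integral_hasDerivAt_right ?_ ?_ (hψ.continuousAt hz')
  · refine (hψ.mono ?_).intervalIntegrable
    rw [uIcc_of_le hz.1.le]
    exact Icc_subset_Icc_right hz.2.le
  · exact (hψ.mono Ioo_subset_Icc_self).stronglyMeasurableAtFilter isOpen_Ioo z hz

theorem contDiffOn_axialPrimitive (hψ : ContinuousOn ψ (Icc 0 1)) :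
    ContDiffOn ℝ 1 (axialPrimitive ψ) (Ioo 0 1) := by
  rw [show (1 : WithTop ℕ∞) = 0 + 1 from rfl, contDiffOn_succ_iff_deriv_of_isOpen isOpen_Ioo]
  refine ⟨fun z hz => (hasDerivAt_axialPrimitive hψ hz).differentiableAt.differentiableWithinAt,
    by simp, ?_⟩
  rw [contDiffOn_zero]
  exact (hψ.mono Ioo_subset_Icc_self).congr fun z hz => (hasDerivAt_axialPrimitive hψ hz).deriv

/-- The primitive vanishes at `0`, and at `1` because `ψ` has mean zero. So it is at most a constant
times `min(z, 1 - z)`, which is at most `2z(1 - z)`. -/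
theorem exists_axial_bound (hψ : ContinuousOn ψ (Icc 0 1)) (hψ0 : ∫ z in (0 : ℝ)..1, ψ z = 0) :
    ∃ C, 0 ≤ C ∧ (∀ z ∈ Icc (0 : ℝ) 1, |ψ z| ≤ C) ∧
      ∀ z ∈ Icc (0 : ℝ) 1, |axialPrimitive ψ z| ≤ C * (z * (1 - z)) := by
  obtain ⟨C, hC⟩ := isCompact_Icc.exists_bound_of_continuousOn hψ
  have hC0 : 0 ≤ C := (norm_nonneg _).trans (hC 0 (by simp))
  refine ⟨2 * C, by linarith, fun z hz => (hC z hz).trans (by linarith), fun z hz => ?_⟩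
  have hint : ∀ a b : ℝ, a ∈ Icc (0 : ℝ) 1 → b ∈ Icc (0 : ℝ) 1 →
      IntervalIntegrable ψ volume a b := fun a b ha hb =>
    (hψ.mono (uIcc_subset_Icc ha hb)).intervalIntegrable
  have h0 : (0 : ℝ) ∈ Icc (0 : ℝ) 1 := by simp
  have h1 : (1 : ℝ) ∈ Icc (0 : ℝ) 1 := by simp
  have b1 : |axialPrimitive ψ z| ≤ C * z := by
    have := intervalIntegral.norm_integral_le_of_norm_le_const (a := 0) (b := z) (f := ψ) (C := C)
      fun t ht => by
        rw [uIoc_of_le hz.1] at ht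
        exact hC t ⟨ht.1.le, ht.2.trans hz.2⟩
    rwa [sub_zero, abs_of_nonneg hz.1] at this
  have b2 : |axialPrimitive ψ z| ≤ C * (1 - z) := by
    have e : axialPrimitive ψ z = -∫ t in z..1, ψ t := by
      have := intervalIntegral.integral_add_adjacent_intervals (hint 0 z h0 hz) (hint z 1 hz h1)
      rw [axialPrimitive]
      linarith
    have := intervalIntegral.norm_integral_le_of_norm_le_const (a := z) (b := 1) (f := ψ) (C := C)
      fun t ht => by
        rw [uIoc_of_le hz.2] at ht
        exact hC t ⟨hz.1.trans ht.1.le, ht.2⟩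
    rwa [e, abs_neg, ← abs_of_nonneg (sub_nonneg.2 hz.2)]
  rcases le_or_gt z (1 / 2) with h | h
  · nlinarith [mul_nonneg hC0 hz.1]
  · nlinarith [mul_nonneg hC0 (sub_nonneg.2 hz.2)]

theorem height_mem {x : V3} (hx : x ∈ cylinder) : x 2 ∈ Ioo (0 : ℝ) 1 := hx.2

/-- The primitive times the axial unit vector is tangential to the lateral wall and vanishes on top
and bottom. -/
theorem integral_axial (hψ : ContinuousOn ψ (Icc 0 1)) (hψ0 : ∫ z in (0 : ℝ)..1, ψ z = 0)
    (hv : IntegrableOn v cylinder)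
    (hG : ∀ j, IntegrableOn (G j) cylinder) (hw : ∀ j, IsWeakPartial cylinder j v (G j)) :
    ∫ x in cylinder, G 2 x * axialPrimitive ψ (x 2) = -∫ x in cylinder, v x * ψ (x 2) := by
  obtain ⟨C, hC, hb, hb'⟩ := exists_axial_bound hψ hψ0
  refine integral_mul_eq_of_tangential (C := C) hv hG hw 2 (F := fun x => axialPrimitive ψ (x 2))
    ((contDiffOn_axialPrimitive hψ).comp (f := fun x : V3 => x 2) (by fun_prop)
      fun x hx => height_mem hx)
    (fun x hx => ?_) (fun x hx => ?_)
    (fun x hx => hb _ (Ioo_subset_Icc_self (height_mem hx))) (fun x hx => ?_)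
  · refine (hb' _ (Ioo_subset_Icc_self (height_mem hx))).trans ?_
    have h2 : x 2 * (1 - x 2) ≤ 1 := by nlinarith [hx.2.1, hx.2.2]
    nlinarith
  · have := (hasDerivAt_axialPrimitive hψ (height_mem hx)).comp_hasFDerivAt x
      (hasFDerivAt_coord 2 x)
    rw [show fderiv ℝ (fun x : V3 => axialPrimitive ψ (x 2)) x = _ from this.fderiv]
    simp
  · have hs := axisSq_lt_one hx
    have h0 : |fderiv ℝ bdryFun x (Pi.single 2 1)| ≤ 1 - axisSq x := by
      rw [fderiv_bdryFun]
      simp only [Pi.single_apply]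
      simp
      rw [abs_of_pos (sub_pos.2 hs)]
      refine mul_le_of_le_one_right (sub_pos.2 hs).le ?_
      rw [abs_le]
      constructor <;> linarith [hx.2.1, hx.2.2]
    rw [abs_mul]
    calc _ ≤ (1 - axisSq x) * (C * (x 2 * (1 - x 2))) :=
          mul_le_mul h0 (hb' _ (Ioo_subset_Icc_self (height_mem hx))) (abs_nonneg _)
            (sub_pos.2 hs).le
      _ = _ := by unfold bdryFun; ring

end Axial

/-! ### Explicit displacements -/

/-- `v ∈ H¹` on the cylinder, with weak derivatives `G 0, G 1, G 2`. -/
structure ScalarH1 (v : V3 → ℝ) (G : Fin 3 → V3 → ℝ) : Prop where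
  memLp : MemLp v 2 (volume.restrict cylinder)
  grad_memLp : ∀ j, MemLp (G j) 2 (volume.restrict cylinder)
  isWeakPartial : ∀ j, IsWeakPartial cylinder j v (G j)

theorem ScalarH1.integrable {v : V3 → ℝ} {G : Fin 3 → V3 → ℝ} (h : ScalarH1 v G) :
    IntegrableOn v cylinder := h.memLp.integrable (by norm_num)

theorem ScalarH1.grad_integrable {v : V3 → ℝ} {G : Fin 3 → V3 → ℝ} (h : ScalarH1 v G) (j : Fin 3) :
    IntegrableOn (G j) cylinder := (h.grad_memLp j).integrable (by norm_num)

theorem IsWeakGradient.scalarH1 {u : V3 → V3} {A : V3 → M3} (h : IsWeakGradient cylinder u A)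
    (i : Fin 3) : ScalarH1 (fun x => u x i) (fun j x => A x i j) :=
  ⟨h.memLp i, h.grad_memLp i, h.isWeakPartial i⟩

theorem isWeakGradient_of_scalarH1 {u : V3 → V3} {A : V3 → M3}
    (h : ∀ i, ScalarH1 (fun x => u x i) (fun j x => A x i j)) : IsWeakGradient cylinder u A :=
  ⟨fun i => (h i).memLp, fun i => (h i).grad_memLp, fun i => (h i).isWeakPartial⟩

theorem ScalarH1.const_mul {v : V3 → ℝ} {G : Fin 3 → V3 → ℝ} (h : ScalarH1 v G) (c : ℝ) :
    ScalarH1 (fun x => c * v x) (fun j x => c * G j x) :=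
  ⟨h.memLp.const_mul c, fun j => (h.grad_memLp j).const_mul c,
    fun j => (h.isWeakPartial j).const_mul c⟩

theorem restrict_cylinder_eq :
    volume.restrict cylinder = (volume.restrict puncturedCylinder : Measure V3) := by
  refine Measure.restrict_congr_set ?_
  have h : puncturedCylinder ⊆ cylinder := fun x hx => hx.1
  exact (ae_eq_set.2 ⟨volume_cylinder_diff_punctured, by rw [sdiff_eq_empty.2 h, measure_empty]⟩)

theorem memLp_of_continuousOn {f : V3 → ℝ} {C : ℝ} (hf : ContinuousOn f puncturedCylinder)
    (hb : ∀ x ∈ puncturedCylinder, |f x| ≤ C) : MemLp f 2 (volume.restrict cylinder) := by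
  refine MemLp.of_bound ?_ C ?_
  · rw [restrict_cylinder_eq]
    exact hf.aestronglyMeasurable isOpen_puncturedCylinder.measurableSet
  · filter_upwards [ae_mem_puncturedCylinder] with x hx using hb x hx

theorem scalarH1_of_hasLineDerivAt {v : V3 → ℝ} {G : Fin 3 → V3 → ℝ} {C : ℝ}
    (hv : ContinuousOn v puncturedCylinder) (hvC : ∀ x ∈ puncturedCylinder, |v x| ≤ C)
    (hG : ∀ j, ContinuousOn (G j) puncturedCylinder)
    (hGC : ∀ j, ∀ x ∈ puncturedCylinder, |G j x| ≤ C)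
    (h : ∀ j, ∀ x ∈ cylinder, HasLineDerivAt ℝ v (G j x) x (Pi.single j 1)) : ScalarH1 v G := by
  have h1 := memLp_of_continuousOn hv hvC
  have h2 := fun j => memLp_of_continuousOn (hG j) (hGC j)
  exact ⟨h1, h2, fun j => isWeakPartial_of_hasLineDerivAt (h1.integrable (by norm_num))
    ((h2 j).integrable (by norm_num)) (h j)⟩

theorem abs_coord_le_one {x : V3} (hx : x ∈ cylinder) (i : Fin 3) : |x i| ≤ 1 := by
  have h := cylinder_subset_closedCylinder hx
  obtain ⟨h1, h2, h3⟩ := h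
  unfold axisSq at h1
  rw [abs_le_one_iff_mul_self_le_one]
  fin_cases i <;> simp <;> nlinarith [sq_nonneg (x 0), sq_nonneg (x 1)]

theorem scalarH1_coord (i : Fin 3) :
    ScalarH1 (fun x => x i) (fun j _ => if i = j then 1 else 0) := by
  refine scalarH1_of_hasLineDerivAt (C := 1) (continuous_apply i).continuousOn
    (fun x hx => abs_coord_le_one hx.1 i) (fun j => continuousOn_const) (fun j x hx => ?_)
    (fun j x hx => ?_)
  · split_ifs <;> simp
  · have := (hasFDerivAt_coord i x).hasLineDerivAt (Pi.single j 1)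
    simpa [Pi.single_apply] using this

theorem scalarH1_zero : ScalarH1 (fun _ => 0) (fun _ _ => 0) := by
  simpa using (scalarH1_coord 0).const_mul 0

section Profile

variable {φ : ℝ × ℝ → ℝ} {k g : ℝ → ℝ} {C : ℝ}

/-- The restriction of `g(s) xᵢ` to a line in direction `i` through the axis. The difference
quotient at `0` is `g(t²)`, so continuity of `g` at `0` suffices. -/
theorem IsProfile.hasDerivAt_avg_sq_mul (h : IsProfile φ k g C) :
    HasDerivAt (fun t : ℝ => g (t ^ 2) * t) (g 0) 0 := by
  rw [hasDerivAt_iff_tendsto_slope]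
  have h1 : Tendsto (fun t : ℝ => g (t ^ 2)) (𝓝 0) (𝓝 (g 0)) := by
    rw [tendsto_iff_dist_tendsto_zero]
    refine squeeze_zero' (g := fun t => C * |t|) (Eventually.of_forall fun _ => dist_nonneg) ?_ ?_
    · filter_upwards [Ioo_mem_nhds (by norm_num : (-1 : ℝ) < 0) zero_lt_one] with t ht
      have := h.abs_avg_sub_le (t ^ 2) ⟨sq_nonneg t, by nlinarith [ht.1, ht.2]⟩
      rwa [Real.sqrt_sq_eq_abs] at this
    · have : Continuous fun t : ℝ => C * |t| := by fun_prop
      simpa using this.tendsto 0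
  refine (h1.mono_left nhdsWithin_le_nhds).congr' ?_
  filter_upwards [self_mem_nhdsWithin] with t ht
  have ht : t ≠ 0 := ht
  simp only [slope, sub_zero, mul_zero, vsub_eq_sub, smul_eq_mul]
  field_simp

theorem IsProfile.contDiffOn_avg_axisSq (h : IsProfile φ k g C) :
    ContDiffOn ℝ 1 (fun x => g (axisSq x)) puncturedCylinder :=
  h.contDiffOn_avg.comp contDiff_axisSq.contDiffOn fun _ hx => axisSq_mem_Ioo hx

/-- The weak derivatives of `g(s) xᵢ`, for `i = 0, 1`. -/
def radialGrad (k g : ℝ → ℝ) (i j : Fin 3) (x : V3) : ℝ :=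
  if j = 2 then 0 else
    (if i = j then g (axisSq x) else 0) + shearFactor k g (axisSq x) * (x i * x j) / 8

theorem abs_coord_mul_coord_le (x : V3) {i j : Fin 3} (hi : i ≠ 2) (hj : j ≠ 2) :
    |x i * x j| ≤ axisSq x := by
  rw [abs_le, axisSq]
  fin_cases i <;> fin_cases j <;> simp at hi hj ⊢ <;>
    constructor <;> nlinarith [sq_nonneg (x 0 - x 1), sq_nonneg (x 0 + x 1), sq_nonneg (x 0),
      sq_nonneg (x 1)]

theorem IsProfile.scalarH1_radial (h : IsProfile φ k g C) {i : Fin 3} (hi : i ≠ 2) :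
    ScalarH1 (fun x => g (axisSq x) * x i) (radialGrad k g i) := by
  have hC := h.nonneg
  have hg : ∀ x ∈ puncturedCylinder, |g (axisSq x)| ≤ C := fun x hx =>
    h.abs_avg_le _ (axisSq_mem_Ico hx.1)
  refine scalarH1_of_hasLineDerivAt (C := 3 * C)
    (h.contDiffOn_avg_axisSq.continuousOn.mul (continuous_apply i).continuousOn) (fun x hx => ?_)
    (fun j => ?_) (fun j x hx => ?_) (fun j x hx => ?_)
  · rw [abs_mul]
    have := mul_le_mul (hg x hx) (abs_coord_le_one hx.1 i) (abs_nonneg _) hC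
    linarith
  · have h1 := h.contDiffOn_avg_axisSq.continuousOn
    have h2 := h.contDiffOn_comp_axisSq.continuousOn
    unfold radialGrad
    split_ifs
    · exact continuousOn_const
    · exact h1.add ((h2.mul (by fun_prop)).div_const 8)
    · exact continuousOn_const.add ((h2.mul (by fun_prop)).div_const 8)
  · unfold radialGrad
    split_ifs with h1 h2
    · simpa using hC
    all_goals
      have h3 := h.abs_shearFactor_mul_le hx (abs_coord_mul_coord_le x hi h1)
      refine (abs_add_le _ _).trans ?_
      rw [abs_div, abs_of_pos (by norm_num : (0 : ℝ) < 8)]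
    · linarith [hg x hx]
    · simp only [abs_zero]
      linarith
  · by_cases hx0 : 0 < axisSq x
    · have hx' : x ∈ puncturedCylinder := ⟨hx, hx0⟩
      have h1 := ((h.hasDerivAt_avg (axisSq_mem_Ioo hx')).comp_hasFDerivAt x
        (hasFDerivAt_axisSq x)).mul (hasFDerivAt_coord i x)
      have h2 := h1.hasLineDerivAt (Pi.single j 1)
      refine HasDerivAt.congr_deriv h2 ?_
      unfold radialGrad
      fin_cases j <;> fin_cases i <;> simp at hi ⊢ <;> ring
    -- On the axis the chain rule is unavailable. In direction `i` the function is `g(t²) t`; in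
    -- every other coordinate direction it is identically zero.
    · have hs : axisSq x = 0 := le_antisymm (not_lt.1 hx0) (axisSq_nonneg x)
      have h00 : x 0 = 0 ∧ x 1 = 0 := by
        unfold axisSq at hs
        constructor <;> nlinarith [sq_nonneg (x 0), sq_nonneg (x 1)]
      have hxi : x i = 0 := by
        fin_cases i
        · exact h00.1
        · exact h00.2
        · exact absurd rfl hi
      change HasDerivAt (fun t : ℝ => g (axisSq (x + t • Pi.single j 1)) *
        (x + t • (Pi.single j 1 : V3)) i) _ 0
      by_cases hij : i = j
      · subst hij
        have e : (fun t : ℝ => g (axisSq (x + t • Pi.single i 1)) *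
            (x + t • (Pi.single i 1 : V3)) i) = fun t => g (t ^ 2) * t := by
          ext t
          have : axisSq (x + t • Pi.single i 1) = t ^ 2 := by
            unfold axisSq
            fin_cases i <;> simp [h00] at hi ⊢
          rw [this]
          simp [hxi]
        rw [e]
        simpa [radialGrad, hi, hxi, hs] using h.hasDerivAt_avg_sq_mul
      · have e : (fun t : ℝ => g (axisSq (x + t • Pi.single j 1)) *
            (x + t • (Pi.single j 1 : V3)) i) = fun t => 0 := by
          ext t
          simp [hxi, hij]
        rw [e]
        simpa [radialGrad, hij, hxi] using hasDerivAt_const (0 : ℝ) (0 : ℝ)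

end Profile

section Axial

variable {ψ : ℝ → ℝ}

theorem continuousOn_axialPrimitive (hψ : ContinuousOn ψ (Icc 0 1)) :
    ContinuousOn (axialPrimitive ψ) (Icc 0 1) := by
  have := intervalIntegral.continuousOn_primitive_interval (a := 0) (b := 1) (f := ψ)
    (μ := volume) (by
      rw [uIcc_of_le zero_le_one]
      exact hψ.integrableOn_Icc)
  rwa [uIcc_of_le zero_le_one] at this

theorem scalarH1_axialPrimitive (hψ : ContinuousOn ψ (Icc 0 1)) :
    ScalarH1 (fun x => axialPrimitive ψ (x 2)) (fun j x => if j = 2 then ψ (x 2) else 0) := by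
  have hc := continuousOn_axialPrimitive hψ
  obtain ⟨C₁, h₁⟩ := isCompact_Icc.exists_bound_of_continuousOn hψ
  obtain ⟨C₂, h₂⟩ := isCompact_Icc.exists_bound_of_continuousOn hc
  have hm : ∀ x ∈ puncturedCylinder, x 2 ∈ Icc (0 : ℝ) 1 := fun x hx =>
    Ioo_subset_Icc_self (height_mem hx.1)
  refine scalarH1_of_hasLineDerivAt (C := max C₁ C₂)
    (hc.comp (continuous_apply 2).continuousOn hm) (fun x hx => ?_) (fun j => ?_)
    (fun j x hx => ?_) (fun j x hx => ?_)
  · exact (h₂ _ (hm x hx)).trans (le_max_right _ _)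
  · split_ifs
    · exact hψ.comp (continuous_apply 2).continuousOn hm
    · exact continuousOn_const
  · have := (h₁ _ (hm x hx)).trans (le_max_left C₁ C₂)
    split_ifs
    · exact this
    · simpa using (norm_nonneg _).trans this
  · have h1 := (hasDerivAt_axialPrimitive hψ (height_mem hx)).comp_hasFDerivAt x
      (hasFDerivAt_coord 2 x)
    refine HasDerivAt.congr_deriv (h1.hasLineDerivAt (Pi.single j 1)) ?_
    fin_cases j <;> simp

end Axial

/-! ### Moments of the force -/

section Moments

variable {φ : ℝ × ℝ → ℝ} {k g : ℝ → ℝ} {C : ℝ} {ψ : ℝ → ℝ}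

/-- The exchange of the first two coordinates. -/
def swapXY : V3 ≃ᵐ V3 := MeasurableEquiv.piCongrLeft (fun _ : Fin 3 => ℝ) (Equiv.swap 0 1)

theorem measurePreserving_swapXY : MeasurePreserving swapXY :=
  volume_measurePreserving_piCongrLeft (fun _ : Fin 3 => ℝ) (Equiv.swap 0 1)

theorem swapXY_apply_swap (x : V3) (i : Fin 3) : swapXY x (Equiv.swap 0 1 i) = x i :=
  Equiv.piCongrLeft_apply_apply (fun _ : Fin 3 => ℝ) (Equiv.swap 0 1) x i

theorem swapXY_zero (x : V3) : swapXY x 0 = x 1 := by simpa using swapXY_apply_swap x 1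

theorem swapXY_one (x : V3) : swapXY x 1 = x 0 := by simpa using swapXY_apply_swap x 0

theorem swapXY_two (x : V3) : swapXY x 2 = x 2 := by
  have := swapXY_apply_swap x 2
  rwa [Equiv.swap_apply_of_ne_of_ne (by decide) (by decide)] at this

/-- The integrand is odd under the exchange of `x` and `y`, which preserves the cylinder. -/
theorem integral_shearDiff (k g : ℝ → ℝ) : ∫ x in cylinder, shearDiff k g x = 0 := by
  have h := measurePreserving_swapXY.setIntegral_preimage_emb swapXY.measurableEmbedding
    (shearDiff k g) cylinder
  have h1 : swapXY ⁻¹' cylinder = cylinder := by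
    ext x
    simp only [cylinder, mem_preimage, mem_ofPred_eq, swapXY_zero, swapXY_one, swapXY_two]
    rw [add_comm]
  have h2 : ∀ x, shearDiff k g (swapXY x) = -shearDiff k g x := fun x => by
    have : axisSq (swapXY x) = axisSq x := by
      simp only [axisSq, swapXY_zero, swapXY_one]; ring
    simp only [shearDiff, this, swapXY_zero, swapXY_one]; ring
  rw [h1] at h
  simp_rw [h2] at h
  rw [integral_neg] at h
  linarith

/-- Integration by parts against a coordinate: the diagonal moment becomes the integral of
`shearDiff`, while in the others the coordinate has zero derivative in the relevant direction. -/
theorem IsProfile.integral_coord_mul_dx (h : IsProfile φ k g C) (j : Fin 3) :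
    ∫ x in cylinder, x j * dx φ (x 0, x 1) = 0 := by
  have hj := scalarH1_coord j
  by_cases h0 : j = 0
  · have := h.integral_shear_dx hj.integrable hj.grad_integrable hj.isWeakPartial
    rw [← this]
    subst h0
    simpa using integral_shearDiff k g
  · have := h.integral_lift_dx hj.integrable hj.grad_integrable hj.isWeakPartial
    simpa [h0] using this

theorem IsProfile.integral_coord_mul_dy (h : IsProfile φ k g C) (j : Fin 3) :
    ∫ x in cylinder, x j * dy φ (x 0, x 1) = 0 := by
  have hj := scalarH1_coord j
  by_cases h0 : j = 1
  · have := h.integral_shear_dy hj.integrable hj.grad_integrable hj.isWeakPartial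
    subst h0
    simpa [integral_shearDiff k g] using this
  · have := h.integral_lift_dy hj.integrable hj.grad_integrable hj.isWeakPartial
    simpa [h0] using this

theorem integral_coord_mul_axial (hψ : ContinuousOn ψ (Icc 0 1))
    (hψ0 : ∫ z in (0 : ℝ)..1, ψ z = 0) {j : Fin 3} (hj2 : j ≠ 2) :
    ∫ x in cylinder, x j * ψ (x 2) = 0 := by
  have hj := scalarH1_coord j
  have := integral_axial hψ hψ0 hj.integrable hj.grad_integrable hj.isWeakPartial
  simpa [hj2] using this

/-- Fubini over horizontal slices; `c` is the area of the unit disc. -/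
theorem integral_height (f : ℝ → ℝ) : ∃ c : ℝ, 0 < c ∧
    ∫ x in cylinder, f (x 2) = (∫ z in (0 : ℝ)..1, f z) * c := by
  let e := MeasurableEquiv.piFinSuccAbove (fun _ : Fin 3 => ℝ) 2
  have he : MeasurePreserving e := volume_preserving_piFinSuccAbove (fun _ : Fin 3 => ℝ) 2
  let B : Set (Fin 2 → ℝ) := {y | y 0 ^ 2 + y 1 ^ 2 < 1}
  have hBo : IsOpen B := isOpen_lt (by fun_prop) continuous_const
  have hB : volume B ≠ ⊤ := by
    refine ((measure_mono fun y hy => ?_).trans_lt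
      (measure_closedBall_lt_top (x := (0 : Fin 2 → ℝ)) (r := 1))).ne
    have hy : y 0 ^ 2 + y 1 ^ 2 < 1 := hy
    rw [mem_closedBall_zero_iff, pi_norm_le_iff_of_nonneg zero_le_one]
    intro i
    rw [Real.norm_eq_abs, abs_le_one_iff_mul_self_le_one]
    fin_cases i <;> simp <;> nlinarith [sq_nonneg (y 0), sq_nonneg (y 1)]
  have hpos : 0 < volume B := hBo.measure_pos volume ⟨0, by simp [B]⟩
  refine ⟨volume.real B, ENNReal.toReal_pos hpos.ne' hB, ?_⟩
  have hpre : e ⁻¹' (Ioo 0 1 ×ˢ B) = cylinder := by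
    ext x
    change ((0 < x 2 ∧ x 2 < 1) ∧ x 0 ^ 2 + x 1 ^ 2 < 1) ↔
      (x 0 ^ 2 + x 1 ^ 2 < 1 ∧ 0 < x 2 ∧ x 2 < 1)
    tauto
  have h := he.setIntegral_preimage_emb e.measurableEmbedding (fun p => f p.1 * 1) (Ioo 0 1 ×ˢ B)
  rw [hpre, Measure.volume_eq_prod,
    setIntegral_prod_mul (μ := volume) (ν := volume) f (fun _ : Fin 2 → ℝ => (1 : ℝ))] at h
  rw [intervalIntegral.integral_of_le zero_le_one, integral_Ioc_eq_integral_Ioo]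
  simp only [mul_one, integral_const, smul_eq_mul, measureReal_restrict_apply_univ] at h
  exact h

theorem integral_height_mul_axial_pos (hψ1 : 0 < ∫ z in (0 : ℝ)..1, z * ψ z) :
    0 < ∫ x in cylinder, x 2 * ψ (x 2) := by
  obtain ⟨c, hc, h⟩ := integral_height fun z => z * ψ z
  rw [h]
  exact mul_pos hψ1 hc

end Moments

/-! ### The loads -/

section Loads

variable {φ : ℝ × ℝ → ℝ} {k g : ℝ → ℝ} {C : ℝ} {ψ : ℝ → ℝ} {u : V3 → V3}

/-- The planar part of the load. -/
def planarLoad (φ : ℝ × ℝ → ℝ) (u : V3 → V3) : ℝ :=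
  ∫ x in cylinder, (u x 0 * dx φ (x 0, x 1) + u x 1 * dy φ (x 0, x 1))

/-- The load of the planar force turned by a right angle. -/
def turnedLoad (φ : ℝ × ℝ → ℝ) (u : V3 → V3) : ℝ :=
  ∫ x in cylinder, (u x 1 * dx φ (x 0, x 1) - u x 0 * dy φ (x 0, x 1))

/-- The axial part of the load. -/
def axialLoad (ψ : ℝ → ℝ) (u : V3 → V3) : ℝ := ∫ x in cylinder, u x 2 * ψ (x 2)

theorem IsProfile.continuousOn_fderiv (h : IsProfile φ k g C) (e : ℝ × ℝ) :
    ContinuousOn (fun x : V3 => fderiv ℝ φ (x 0, x 1) e) puncturedCylinder :=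
  ((h.contDiffOn_potential.continuousOn_fderiv_of_isOpen isOpen_disc le_rfl).comp
    (f := fun x : V3 => (x 0, x 1)) (by fun_prop) fun _ hx => mk_mem_disc hx.1).clm_apply
    continuousOn_const

theorem IsProfile.memLp_dx (h : IsProfile φ k g C) :
    MemLp (fun x : V3 => dx φ (x 0, x 1)) 2 (volume.restrict cylinder) :=
  memLp_of_continuousOn (h.continuousOn_fderiv _) fun _ hx => h.abs_dx_le _ (mk_mem_disc hx.1)

theorem IsProfile.memLp_dy (h : IsProfile φ k g C) :
    MemLp (fun x : V3 => dy φ (x 0, x 1)) 2 (volume.restrict cylinder) :=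
  memLp_of_continuousOn (h.continuousOn_fderiv _) fun _ hx => h.abs_dy_le _ (mk_mem_disc hx.1)

theorem memLp_axial (hψ : ContinuousOn ψ (Icc 0 1)) :
    MemLp (fun x : V3 => ψ (x 2)) 2 (volume.restrict cylinder) := by
  simpa using (scalarH1_axialPrimitive hψ).grad_memLp 2

/-- The action of a matrix on a load. -/
theorem load_mulVec (h : IsProfile φ k g C) (hψ : ContinuousOn ψ (Icc 0 1))
    (hu : ∀ i, MemLp (fun x => u x i) 2 (volume.restrict cylinder)) (R : M3) :
    load cylinder (force φ ψ) (fun x => R *ᵥ u x) =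
      ∑ j, (R 0 j * (∫ x in cylinder, u x j * dx φ (x 0, x 1)) +
        R 1 j * (∫ x in cylinder, u x j * dy φ (x 0, x 1)) +
        R 2 j * ∫ x in cylinder, u x j * ψ (x 2)) := by
  have i0 : ∀ j, Integrable (fun x => u x j * dx φ (x 0, x 1)) (volume.restrict cylinder) :=
    fun j => (hu j).integrable_mul h.memLp_dx
  have i1 : ∀ j, Integrable (fun x => u x j * dy φ (x 0, x 1)) (volume.restrict cylinder) :=
    fun j => (hu j).integrable_mul h.memLp_dy
  have i2 : ∀ j, Integrable (fun x => u x j * ψ (x 2)) (volume.restrict cylinder) :=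
    fun j => (hu j).integrable_mul (memLp_axial hψ)
  have e : ∀ x, force φ ψ x ⬝ᵥ R *ᵥ u x = ∑ j, (R 0 j * (u x j * dx φ (x 0, x 1)) +
      R 1 j * (u x j * dy φ (x 0, x 1)) + R 2 j * (u x j * ψ (x 2))) := by
    intro x
    simp only [force, dotProduct, Matrix.mulVec, Fin.sum_univ_three]
    simp
    ring
  simp_rw [load, e]
  have i01 : ∀ j, Integrable (fun x => R 0 j * (u x j * dx φ (x 0, x 1)) +
      R 1 j * (u x j * dy φ (x 0, x 1))) (volume.restrict cylinder) := fun j =>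
    ((i0 j).const_mul _).add ((i1 j).const_mul _)
  have i012 : ∀ j, Integrable (fun x => R 0 j * (u x j * dx φ (x 0, x 1)) +
      R 1 j * (u x j * dy φ (x 0, x 1)) + R 2 j * (u x j * ψ (x 2))) (volume.restrict cylinder) :=
    fun j => (i01 j).add ((i2 j).const_mul _)
  rw [integral_finsetSum _ fun j _ => i012 j]
  refine Finset.sum_congr rfl fun j _ => ?_
  rw [integral_add (i01 j) ((i2 j).const_mul _),
    integral_add ((i0 j).const_mul _) ((i1 j).const_mul _), integral_const_mul,
    integral_const_mul, integral_const_mul]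

theorem planarLoad_eq (h : IsProfile φ k g C)
    (hu : ∀ i, MemLp (fun x => u x i) 2 (volume.restrict cylinder)) :
    planarLoad φ u = (∫ x in cylinder, u x 0 * dx φ (x 0, x 1)) +
      ∫ x in cylinder, u x 1 * dy φ (x 0, x 1) :=
  integral_add ((hu 0).integrable_mul h.memLp_dx) ((hu 1).integrable_mul h.memLp_dy)

theorem turnedLoad_eq (h : IsProfile φ k g C)
    (hu : ∀ i, MemLp (fun x => u x i) 2 (volume.restrict cylinder)) :
    turnedLoad φ u = (∫ x in cylinder, u x 1 * dx φ (x 0, x 1)) -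
      ∫ x in cylinder, u x 0 * dy φ (x 0, x 1) :=
  integral_sub ((hu 1).integrable_mul h.memLp_dx) ((hu 0).integrable_mul h.memLp_dy)

theorem load_eq (h : IsProfile φ k g C) (hψ : ContinuousOn ψ (Icc 0 1))
    (hu : ∀ i, MemLp (fun x => u x i) 2 (volume.restrict cylinder)) :
    load cylinder (force φ ψ) u = planarLoad φ u + axialLoad ψ u := by
  have := load_mulVec h hψ hu 1
  simp only [Matrix.one_mulVec] at this
  rw [this, planarLoad_eq h hu, axialLoad, Fin.sum_univ_three]
  simp

/-- The rotation about the axis with cosine `c` and sine `s`. -/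
def rotZ (c s : ℝ) : M3 := !![c, -s, 0; s, c, 0; 0, 0, 1]

theorem rotZ_mem {c s : ℝ} (h : c ^ 2 + s ^ 2 = 1) :
    rotZ c s ∈ Matrix.specialOrthogonalGroup (Fin 3) ℝ := by
  rw [Matrix.mem_specialOrthogonalGroup_iff, Matrix.mem_orthogonalGroup_iff]
  constructor
  · ext i j
    fin_cases i <;> fin_cases j <;> simp [rotZ, Matrix.mul_apply, Fin.sum_univ_three] <;> linarith
  · rw [Matrix.det_fin_three]
    simp [rotZ]
    linarith

/-- The third row and column are unit vectors, so their other entries vanish, and the remaining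
block is a plane rotation. -/
theorem exists_eq_rotZ {R : M3} (hR : R ∈ Matrix.specialOrthogonalGroup (Fin 3) ℝ)
    (h22 : R 2 2 = 1) : ∃ c s, c ^ 2 + s ^ 2 = 1 ∧ R = rotZ c s := by
  obtain ⟨h1, hdet⟩ := Matrix.mem_specialOrthogonalGroup_iff.1 hR
  have h2 := (Matrix.mem_orthogonalGroup_iff' _ _).1 h1
  have h1 := (Matrix.mem_orthogonalGroup_iff _ _).1 h1
  have r : ∀ i j, ∑ l, R i l * R j l = (1 : M3) i j := fun i j => by
    rw [← h1, Matrix.mul_apply]; rfl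
  have c : ∀ i j, ∑ l, R l i * R l j = (1 : M3) i j := fun i j => by
    rw [← h2, Matrix.mul_apply]; rfl
  have r22 := r 2 2
  have c22 := c 2 2
  have c00 := c 0 0
  have c01 := c 0 1
  have c11 := c 1 1
  simp only [Fin.sum_univ_three, h22] at r22 c22 c00 c01 c11
  simp at r22 c22 c00 c01 c11
  have z20 : R 2 0 = 0 := by nlinarith [mul_self_nonneg (R 2 0), mul_self_nonneg (R 2 1)]
  have z21 : R 2 1 = 0 := by nlinarith [mul_self_nonneg (R 2 0), mul_self_nonneg (R 2 1)]
  have z02 : R 0 2 = 0 := by nlinarith [mul_self_nonneg (R 0 2), mul_self_nonneg (R 1 2)]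
  have z12 : R 1 2 = 0 := by nlinarith [mul_self_nonneg (R 0 2), mul_self_nonneg (R 1 2)]
  rw [Matrix.det_fin_three] at hdet
  simp only [z20, z21, z02, z12, h22] at hdet c00 c01 c11
  -- The inverse of the block is both its transpose and its adjugate; the combinations spell out
  -- this comparison.
  have e1 : R 1 1 = R 0 0 := by
    linear_combination (-(R 1 1)) * c00 + R 1 0 * c01 + R 0 0 * hdet
  have e2 : R 0 1 = -R 1 0 := by
    linear_combination (-(R 0 1)) * c00 + R 0 0 * c01 - R 1 0 * hdet
  refine ⟨R 0 0, R 1 0, by linarith, ?_⟩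
  ext i j
  fin_cases i <;> fin_cases j <;> simp [rotZ, z20, z21, z02, z12, h22, e1, e2]

/-- All first moments of the force vanish except `∫ z ψ > 0`, so the load of `(R - I)x` is a nonzero
multiple of `R 2 2 - 1`. -/
theorem mem_rotationKernel_iff (h : IsProfile φ k g C) (hψ : ContinuousOn ψ (Icc 0 1))
    (hψ0 : ∫ z in (0 : ℝ)..1, ψ z = 0) (hψ1 : 0 < ∫ z in (0 : ℝ)..1, z * ψ z) {R : M3} :
    R ∈ rotationKernel cylinder (force φ ψ) ↔ ∃ c s, c ^ 2 + s ^ 2 = 1 ∧ R = rotZ c s := by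
  have hl : load cylinder (force φ ψ) (fun x => (R - 1) *ᵥ x) =
      (R 2 2 - 1) * ∫ x in cylinder, x 2 * ψ (x 2) := by
    rw [load_mulVec (u := fun x => x) h hψ (fun i => (scalarH1_coord i).memLp), Fin.sum_univ_three]
    simp only [h.integral_coord_mul_dx, h.integral_coord_mul_dy,
      integral_coord_mul_axial hψ hψ0 (by decide : (0 : Fin 3) ≠ 2),
      integral_coord_mul_axial hψ hψ0 (by decide : (1 : Fin 3) ≠ 2)]
    simp
  constructor
  · rintro ⟨h1, h2⟩
    rw [hl, mul_eq_zero] at h2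
    have := h2.resolve_right (integral_height_mul_axial_pos hψ1).ne'
    exact exists_eq_rotZ h1 (by linarith)
  · rintro ⟨c, s, hcs, rfl⟩
    refine ⟨rotZ_mem hcs, ?_⟩
    rw [hl]
    simp [rotZ]

theorem load_rotZ (h : IsProfile φ k g C) (hψ : ContinuousOn ψ (Icc 0 1))
    (hu : ∀ i, MemLp (fun x => u x i) 2 (volume.restrict cylinder)) (c s : ℝ) :
    load cylinder (force φ ψ) (fun x => (rotZ c s - 1) *ᵥ u x) =
      c * planarLoad φ u - s * turnedLoad φ u - planarLoad φ u := by
  rw [load_mulVec h hψ hu, Fin.sum_univ_three, planarLoad_eq h hu, turnedLoad_eq h hu]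
  simp [rotZ]
  ring

theorem mul_sub_mul_le_sqrt {a b c s : ℝ} (h : c ^ 2 + s ^ 2 = 1) :
    c * a - s * b ≤ Real.sqrt (a ^ 2 + b ^ 2) := by
  refine (le_abs_self _).trans (Real.abs_le_sqrt ?_)
  have : a ^ 2 + b ^ 2 = (c ^ 2 + s ^ 2) * (a ^ 2 + b ^ 2) := by rw [h, one_mul]
  nlinarith [sq_nonneg (c * b + s * a)]

theorem exists_mul_sub_mul_eq_sqrt (a b : ℝ) :
    ∃ c s : ℝ, c ^ 2 + s ^ 2 = 1 ∧ c * a - s * b = Real.sqrt (a ^ 2 + b ^ 2) := by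
  rcases (Real.sqrt_nonneg (a ^ 2 + b ^ 2)).eq_or_lt with h | h
  · have h0 : a ^ 2 + b ^ 2 = 0 := by
      rw [← Real.sq_sqrt (by positivity : 0 ≤ a ^ 2 + b ^ 2), ← h]; norm_num
    have ha : a = 0 := by nlinarith [sq_nonneg a, sq_nonneg b]
    exact ⟨1, 0, by norm_num, by rw [← h, ha]; ring⟩
  · have h2 := Real.sq_sqrt (by positivity : 0 ≤ a ^ 2 + b ^ 2)
    set n := Real.sqrt (a ^ 2 + b ^ 2)
    refine ⟨a / n, -b / n, ?_, ?_⟩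
    · field_simp
      linarith
    · field_simp
      linarith

/-- The maximum of `cP - sT` on the unit circle is the length of `(P, T)`. The remaining `-P` will
cancel the planar part of `ℒ(u)` in the energy. -/
theorem sSup_load_eq (h : IsProfile φ k g C) (hψ : ContinuousOn ψ (Icc 0 1))
    (hψ0 : ∫ z in (0 : ℝ)..1, ψ z = 0) (hψ1 : 0 < ∫ z in (0 : ℝ)..1, z * ψ z)
    (hu : ∀ i, MemLp (fun x => u x i) 2 (volume.restrict cylinder)) :
    sSup ((fun R : M3 => load cylinder (force φ ψ) (fun x => (R - 1) *ᵥ u x)) ''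
      rotationKernel cylinder (force φ ψ)) =
      Real.sqrt (planarLoad φ u ^ 2 + turnedLoad φ u ^ 2) - planarLoad φ u := by
  refine IsGreatest.csSup_eq ⟨?_, ?_⟩
  · obtain ⟨c, s, hcs, he⟩ := exists_mul_sub_mul_eq_sqrt (planarLoad φ u) (turnedLoad φ u)
    refine ⟨rotZ c s, (mem_rotationKernel_iff h hψ hψ0 hψ1).2 ⟨c, s, hcs, rfl⟩, ?_⟩
    simp only [load_rotZ h hψ hu, he]
  · rintro _ ⟨R, hR, rfl⟩
    obtain ⟨c, s, hcs, rfl⟩ := (mem_rotationKernel_iff h hψ hψ0 hψ1).1 hR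
    simp only [load_rotZ h hψ hu]
    linarith [mul_sub_mul_le_sqrt (a := planarLoad φ u) (b := turnedLoad φ u) hcs]

end Loads

/-! ### The inner product of matrix fields -/

/-- Square integrable matrix fields on the cylinder. -/
def MemL2 (A : V3 → M3) : Prop := ∀ i j, MemLp (fun x => A x i j) 2 (volume.restrict cylinder)

/-- The `L²` inner product of matrix fields. -/
def innerL2 (A B : V3 → M3) : ℝ := ∫ x in cylinder, ∑ i, ∑ j, A x i j * B x i j

section InnerL2

variable {A B D : V3 → M3}

theorem MemL2.add (hA : MemL2 A) (hB : MemL2 B) : MemL2 (A + B) := fun i j =>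
  (hA i j).add (hB i j)

theorem MemL2.const_smul (hA : MemL2 A) (c : ℝ) : MemL2 (c • A) := fun i j => (hA i j).const_mul c

theorem MemL2.symPart (hA : MemL2 A) : MemL2 (symPart A) := fun i j =>
  ((hA i j).add (hA j i)).const_mul (1 / 2)

theorem MemL2.integrable (hA : MemL2 A) (hB : MemL2 B) :
    Integrable (fun x => ∑ i, ∑ j, A x i j * B x i j) (volume.restrict cylinder) :=
  integrable_finsetSum _ fun i _ => integrable_finsetSum _ fun j _ =>
    (hA i j).integrable_mul (hB i j)

theorem innerL2_comm (A B : V3 → M3) : innerL2 A B = innerL2 B A := by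
  simp only [innerL2, mul_comm]

theorem innerL2_add_left (hA : MemL2 A) (hB : MemL2 B) (hD : MemL2 D) :
    innerL2 (A + B) D = innerL2 A D + innerL2 B D := by
  rw [innerL2, innerL2, innerL2, ← integral_add (hA.integrable hD) (hB.integrable hD)]
  simp only [Pi.add_apply, Matrix.add_apply, add_mul, Finset.sum_add_distrib]

theorem innerL2_smul_left (c : ℝ) (A B : V3 → M3) : innerL2 (c • A) B = c * innerL2 A B := by
  rw [innerL2, innerL2, ← integral_const_mul]
  simp only [Pi.smul_apply, Matrix.smul_apply, smul_eq_mul, Finset.mul_sum, mul_assoc]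

theorem innerL2_add_right (hA : MemL2 A) (hB : MemL2 B) (hD : MemL2 D) :
    innerL2 D (A + B) = innerL2 D A + innerL2 D B := by
  rw [innerL2_comm, innerL2_add_left hA hB hD, innerL2_comm A, innerL2_comm B]

theorem innerL2_smul_right (c : ℝ) (A B : V3 → M3) : innerL2 A (c • B) = c * innerL2 A B := by
  rw [innerL2_comm, innerL2_smul_left, innerL2_comm]

theorem innerL2_self_nonneg (A : V3 → M3) : 0 ≤ innerL2 A A :=
  integral_nonneg fun _ => Finset.sum_nonneg fun _ _ => Finset.sum_nonneg fun _ _ =>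
    mul_self_nonneg _

theorem MemL2.ae_eq_zero (hA : MemL2 A) (h : innerL2 A A = 0) :
    ∀ᵐ x ∂volume.restrict cylinder, A x = 0 := by
  have hnn : ∀ x i, 0 ≤ ∑ j, A x i j * A x i j := fun x i =>
    Finset.sum_nonneg fun _ _ => mul_self_nonneg _
  rw [innerL2, integral_eq_zero_iff_of_nonneg (fun x => Finset.sum_nonneg fun i _ => hnn x i)
    (hA.integrable hA)] at h
  filter_upwards [h] with x hx
  ext i j
  have h1 := (Finset.sum_eq_zero_iff_of_nonneg fun i _ => hnn x i).1 hx i (Finset.mem_univ i)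
  have h2 := (Finset.sum_eq_zero_iff_of_nonneg fun j _ => mul_self_nonneg _).1 h1 j
    (Finset.mem_univ j)
  exact mul_self_eq_zero.1 h2

theorem innerL2_congr_right {B' : V3 → M3} (h : B =ᵐ[volume.restrict cylinder] B') :
    innerL2 A B = innerL2 A B' := by
  refine integral_congr_ae ?_
  filter_upwards [h] with x hx
  rw [hx]

theorem innerL2_congr {A' B' : V3 → M3} (hA : A =ᵐ[volume.restrict cylinder] A')
    (h : B =ᵐ[volume.restrict cylinder] B') : innerL2 A B = innerL2 A' B' := by
  rw [innerL2_congr_right h, innerL2_comm, innerL2_congr_right hA, innerL2_comm]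

end InnerL2

theorem IsWeakGradient.memL2 {u : V3 → V3} {A : V3 → M3} (h : IsWeakGradient cylinder u A) :
    MemL2 A := h.grad_memLp

section Density

attribute [local instance] Matrix.frobeniusNormedAddCommGroup Matrix.frobeniusNormedSpace

theorem IsAdmissibleDensity.quadForm_eq_sum {W : M3 → ℝ≥0∞} (h : IsAdmissibleDensity W) {F : M3}
    (hF : F.IsSymm) : quadForm W F = 4 * ∑ i, ∑ j, F i j * F i j := by
  rw [h.quadForm_eq F hF, Matrix.frobenius_norm_def, ← Real.sqrt_eq_rpow, Real.sq_sqrt]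
  · congr 1
    refine Finset.sum_congr rfl fun i _ => Finset.sum_congr rfl fun j _ => ?_
    rw [Real.rpow_two, Real.norm_eq_abs, sq_abs, sq]
  · exact Finset.sum_nonneg fun _ _ => Finset.sum_nonneg fun _ _ => by positivity

end Density

theorem isSymm_strain (Ω : Set V3) (u : V3 → V3) (x : V3) : (strain Ω u x).IsSymm := by
  rw [strain, Matrix.IsSymm, Matrix.transpose_smul, Matrix.transpose_add,
    Matrix.transpose_transpose, add_comm]

/-! ### The strains of the explicit displacements -/

section Strains

variable {φ : ℝ × ℝ → ℝ} {k g : ℝ → ℝ} {C : ℝ} {ψ : ℝ → ℝ}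

/-- The strain caused by the planar force. -/
def planarStrain (φ : ℝ × ℝ → ℝ) (k g : ℝ → ℝ) (x : V3) : M3 :=
  !![(shearDiff k g x - liftPotential φ x) / 16, shearProd k g x / 16, 0;
    shearProd k g x / 16, (-shearDiff k g x - liftPotential φ x) / 16, 0;
    0, 0, 0]

/-- The strain caused by the planar force turned by a right angle. -/
def turnedStrain (k g : ℝ → ℝ) (x : V3) : M3 :=
  !![-shearProd k g x / 8, shearDiff k g x / 8, 0;
    shearDiff k g x / 8, shearProd k g x / 8, 0;
    0, 0, 0]

/-- The strain caused by the axial force. -/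
def axialStrain (ψ : ℝ → ℝ) (x : V3) : M3 :=
  !![0, 0, 0; 0, 0, 0; 0, 0, -axialPrimitive ψ (x 2) / 8]

theorem IsProfile.memLp_shearDiff (h : IsProfile φ k g C) :
    MemLp (shearDiff k g) 2 (volume.restrict cylinder) :=
  memLp_of_continuousOn h.contDiffOn_shearDiff.continuousOn fun _ hx => h.abs_shearDiff_le hx

theorem IsProfile.memLp_shearProd (h : IsProfile φ k g C) :
    MemLp (shearProd k g) 2 (volume.restrict cylinder) :=
  memLp_of_continuousOn h.contDiffOn_shearProd.continuousOn fun _ hx => h.abs_shearProd_le hx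

theorem IsProfile.memLp_lift (h : IsProfile φ k g C) :
    MemLp (liftPotential φ) 2 (volume.restrict cylinder) := by
  refine memLp_of_continuousOn (C := C)
    (h.contDiffOn_lift.continuousOn.mono fun _ hx => hx.1) fun x hx => ?_
  have := h.abs_lift_le hx.1
  nlinarith [h.nonneg, axisSq_nonneg x]

theorem memLp_axialPrimitive (hψ : ContinuousOn ψ (Icc 0 1)) :
    MemLp (fun x : V3 => axialPrimitive ψ (x 2)) 2 (volume.restrict cylinder) :=
  (scalarH1_axialPrimitive hψ).memLp

theorem memLp_div {f : V3 → ℝ} (hf : MemLp f 2 (volume.restrict cylinder)) (c : ℝ) :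
    MemLp (fun x => f x / c) 2 (volume.restrict cylinder) := by
  simpa only [div_eq_inv_mul] using hf.const_mul c⁻¹

theorem IsProfile.memL2_planarStrain (h : IsProfile φ k g C) : MemL2 (planarStrain φ k g) := by
  intro i j
  fin_cases i <;> fin_cases j <;> simp [planarStrain]
  · exact memLp_div (h.memLp_shearDiff.sub h.memLp_lift) 16
  · exact memLp_div h.memLp_shearProd 16
  · exact memLp_div h.memLp_shearProd 16
  · exact memLp_div (h.memLp_shearDiff.neg.sub h.memLp_lift) 16

theorem IsProfile.memL2_turnedStrain (h : IsProfile φ k g C) : MemL2 (turnedStrain k g) := by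
  intro i j
  fin_cases i <;> fin_cases j <;> simp [turnedStrain]
  · exact memLp_div h.memLp_shearProd.neg 8
  · exact memLp_div h.memLp_shearDiff 8
  · exact memLp_div h.memLp_shearDiff 8
  · exact memLp_div h.memLp_shearProd 8

theorem memL2_axialStrain (hψ : ContinuousOn ψ (Icc 0 1)) : MemL2 (axialStrain ψ) := by
  intro i j
  fin_cases i <;> fin_cases j <;> simp [axialStrain]
  exact memLp_div (memLp_axialPrimitive hψ).neg 8

/-- The strains are orthogonal at every point: turning the trace-free part makes it orthogonal to
itself, and multiples of the identity are orthogonal to trace-free matrices. -/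
theorem innerL2_planar_turned : innerL2 (planarStrain φ k g) (turnedStrain k g) = 0 := by
  rw [innerL2, ← integral_zero V3 ℝ (μ := volume.restrict cylinder)]
  congr 1
  ext x
  simp [planarStrain, turnedStrain, Fin.sum_univ_three]
  ring

theorem innerL2_planar_axial : innerL2 (planarStrain φ k g) (axialStrain ψ) = 0 := by
  rw [innerL2, ← integral_zero V3 ℝ (μ := volume.restrict cylinder)]
  congr 1
  ext x
  simp [planarStrain, axialStrain, Fin.sum_univ_three]

theorem innerL2_turned_axial : innerL2 (turnedStrain k g) (axialStrain ψ) = 0 := by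
  rw [innerL2, ← integral_zero V3 ℝ (μ := volume.restrict cylinder)]
  congr 1
  ext x
  simp [turnedStrain, axialStrain, Fin.sum_univ_three]

variable {u : V3 → V3} {A : V3 → M3}

/-- The stress `8 turnedStrain` balances the turned force `(-φ_y, φ_x)` without traction; being
symmetric, it only sees the symmetric part of the gradient. -/
theorem IsWeakGradient.turnedLoad_eq_innerL2 (hu : IsWeakGradient cylinder u A)
    (h : IsProfile φ k g C) :
    turnedLoad φ u = 8 * innerL2 (turnedStrain k g) (symPart A) := by
  have h0 := hu.scalarH1 0
  have h1 := hu.scalarH1 1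
  have e0 := h.integral_shear_dy h0.integrable h0.grad_integrable h0.isWeakPartial
  have e1 := h.integral_shear_dx h1.integrable h1.grad_integrable h1.isWeakPartial
  have i0 : Integrable (fun x => A x 0 0 * -shearProd k g x + A x 0 1 * shearDiff k g x)
      (volume.restrict cylinder) :=
    ((hu.grad_memLp 0 0).integrable_mul h.memLp_shearProd.neg).add
      ((hu.grad_memLp 0 1).integrable_mul h.memLp_shearDiff)
  have i1 : Integrable (fun x => A x 1 0 * shearDiff k g x + A x 1 1 * shearProd k g x)
      (volume.restrict cylinder) :=
    ((hu.grad_memLp 1 0).integrable_mul h.memLp_shearDiff).add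
      ((hu.grad_memLp 1 1).integrable_mul h.memLp_shearProd)
  rw [turnedLoad_eq h hu.memLp, ← e1, sub_eq_add_neg, ← e0, ← integral_add i1 i0, innerL2,
    ← integral_const_mul]
  congr 1
  ext x
  simp [turnedStrain, symPart, Fin.sum_univ_three]
  ring

/-- Both `S` and `-φ I` balance `∇φ`. Their average is used because it is 8 times an actual strain,
that of `planarField`. -/
theorem IsWeakGradient.planarLoad_eq_innerL2 (hu : IsWeakGradient cylinder u A)
    (h : IsProfile φ k g C) :
    planarLoad φ u = 8 * innerL2 (planarStrain φ k g) (symPart A) := by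
  have h0 := hu.scalarH1 0
  have h1 := hu.scalarH1 1
  have e0 := h.integral_shear_dx h0.integrable h0.grad_integrable h0.isWeakPartial
  have e1 := h.integral_shear_dy h1.integrable h1.grad_integrable h1.isWeakPartial
  have f0 := h.integral_lift_dx h0.integrable h0.grad_integrable h0.isWeakPartial
  have f1 := h.integral_lift_dy h1.integrable h1.grad_integrable h1.isWeakPartial
  have i0 : Integrable (fun x => A x 0 0 * shearDiff k g x + A x 0 1 * shearProd k g x)
      (volume.restrict cylinder) :=
    ((hu.grad_memLp 0 0).integrable_mul h.memLp_shearDiff).add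
      ((hu.grad_memLp 0 1).integrable_mul h.memLp_shearProd)
  have i1 : Integrable (fun x => A x 1 0 * -shearProd k g x + A x 1 1 * shearDiff k g x)
      (volume.restrict cylinder) :=
    ((hu.grad_memLp 1 0).integrable_mul h.memLp_shearProd.neg).add
      ((hu.grad_memLp 1 1).integrable_mul h.memLp_shearDiff)
  have j0 : Integrable (fun x => A x 0 0 * liftPotential φ x) (volume.restrict cylinder) :=
    (hu.grad_memLp 0 0).integrable_mul h.memLp_lift
  have j1 : Integrable (fun x => A x 1 1 * liftPotential φ x) (volume.restrict cylinder) :=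
    (hu.grad_memLp 1 1).integrable_mul h.memLp_lift
  have key : 8 * innerL2 (planarStrain φ k g) (symPart A) =
      1 / 2 * (((∫ x in cylinder, (A x 0 0 * shearDiff k g x + A x 0 1 * shearProd k g x)) -
        ∫ x in cylinder, (A x 1 0 * -shearProd k g x + A x 1 1 * shearDiff k g x)) -
        ((∫ x in cylinder, A x 0 0 * liftPotential φ x) +
          ∫ x in cylinder, A x 1 1 * liftPotential φ x)) := by
    have i01 : Integrable (fun x => A x 0 0 * shearDiff k g x + A x 0 1 * shearProd k g x -
        (A x 1 0 * -shearProd k g x + A x 1 1 * shearDiff k g x)) (volume.restrict cylinder) :=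
      i0.sub i1
    have j01 : Integrable (fun x => A x 0 0 * liftPotential φ x + A x 1 1 * liftPotential φ x)
        (volume.restrict cylinder) := j0.add j1
    rw [← integral_sub i0 i1, ← integral_add j0 j1, ← integral_sub i01 j01, innerL2,
      ← integral_const_mul, ← integral_const_mul]
    congr 1
    ext x
    simp [planarStrain, symPart, Fin.sum_univ_three]
    ring
  rw [key, planarLoad_eq h hu.memLp, e0, e1, f0, f1]
  ring

theorem IsWeakGradient.axialLoad_eq_innerL2 (hu : IsWeakGradient cylinder u A)
    (hψ : ContinuousOn ψ (Icc 0 1)) (hψ0 : ∫ z in (0 : ℝ)..1, ψ z = 0) :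
    axialLoad ψ u = 8 * innerL2 (axialStrain ψ) (symPart A) := by
  have h2 := hu.scalarH1 2
  have e := integral_axial hψ hψ0 h2.integrable h2.grad_integrable h2.isWeakPartial
  rw [axialLoad, ← neg_neg (∫ x in cylinder, u x 2 * ψ (x 2)), ← e, innerL2, ← integral_const_mul,
    ← integral_neg]
  congr 1
  ext x
  simp [axialStrain, symPart, Fin.sum_univ_three]
  ring

/-- The displacement caused by the planar force. -/
def planarField (g : ℝ → ℝ) (x : V3) : V3 := ![g (axisSq x) * x 0, g (axisSq x) * x 1, 0]

/-- The displacement caused by the planar force turned by a right angle. -/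
def turnedField (g : ℝ → ℝ) (x : V3) : V3 :=
  ![-2 * (g (axisSq x) * x 1), 2 * (g (axisSq x) * x 0), 0]

/-- The displacement caused by the axial force. -/
def axialField (ψ : ℝ → ℝ) (x : V3) : V3 :=
  ![0, 0, -1 / 8 * axialPrimitive (axialPrimitive ψ) (x 2)]

/-- The gradient of `planarField`. -/
def planarGrad (k g : ℝ → ℝ) (x : V3) : M3 :=
  ![fun j => radialGrad k g 0 j x, fun j => radialGrad k g 1 j x, fun _ => 0]

/-- The gradient of `turnedField`. -/
def turnedGrad (k g : ℝ → ℝ) (x : V3) : M3 :=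
  ![fun j => -2 * radialGrad k g 1 j x, fun j => 2 * radialGrad k g 0 j x, fun _ => 0]

/-- The gradient of `axialField`. -/
def axialGrad (ψ : ℝ → ℝ) (x : V3) : M3 :=
  ![fun _ => 0, fun _ => 0, fun j => -1 / 8 * if j = 2 then axialPrimitive ψ (x 2) else 0]

theorem IsProfile.isWeakGradient_planarField (h : IsProfile φ k g C) :
    IsWeakGradient cylinder (planarField g) (planarGrad k g) := by
  refine isWeakGradient_of_scalarH1 fun i => ?_
  fin_cases i
  · exact h.scalarH1_radial (by decide)
  · exact h.scalarH1_radial (by decide)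
  · exact scalarH1_zero

theorem IsProfile.isWeakGradient_turnedField (h : IsProfile φ k g C) :
    IsWeakGradient cylinder (turnedField g) (turnedGrad k g) := by
  refine isWeakGradient_of_scalarH1 fun i => ?_
  fin_cases i
  · exact (h.scalarH1_radial (by decide)).const_mul (-2)
  · exact (h.scalarH1_radial (by decide)).const_mul 2
  · exact scalarH1_zero

theorem isWeakGradient_axialField (hψ : ContinuousOn ψ (Icc 0 1)) :
    IsWeakGradient cylinder (axialField ψ) (axialGrad ψ) := by
  refine isWeakGradient_of_scalarH1 fun i => ?_
  fin_cases i
  · exact scalarH1_zero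
  · exact scalarH1_zero
  · exact (scalarH1_axialPrimitive (continuousOn_axialPrimitive hψ)).const_mul (-1 / 8)

theorem symPart_apply (A : V3 → M3) (x : V3) (i j : Fin 3) :
    symPart A x i j = 1 / 2 * (A x i j + A x j i) := by
  simp [symPart]

theorem symPart_turnedGrad : symPart (turnedGrad k g) = turnedStrain k g := by
  ext x i j
  rw [symPart_apply]
  fin_cases i <;> fin_cases j <;>
    simp [turnedGrad, radialGrad, turnedStrain, shearDiff, shearProd] <;> ring

theorem symPart_axialGrad : symPart (axialGrad ψ) = axialStrain ψ := by
  ext x i j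
  rw [symPart_apply]
  fin_cases i <;> fin_cases j <;> simp [axialGrad, axialStrain]
  ring

theorem IsProfile.symPart_planarGrad (h : IsProfile φ k g C) :
    symPart (planarGrad k g) =ᵐ[volume.restrict cylinder] planarStrain φ k g := by
  filter_upwards [ae_mem_puncturedCylinder] with x hx
  have hs := hx.2.ne'
  -- The definition of the shear factor solved for `k`: `k = -16g - sP`.
  have e : liftPotential φ x = -16 * g (axisSq x) -
      (x 0 ^ 2 + x 1 ^ 2) * shearFactor k g (axisSq x) := by
    have : (x 0 ^ 2 + x 1 ^ 2) * shearFactor k g (axisSq x) =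
        16 * (-k (axisSq x) / 16 - g (axisSq x)) := by
      rw [shearFactor, ← axisSq, mul_div_cancel₀ _ hs]
    rw [this, h.lift_eq hx.1]
    ring
  ext i j
  rw [symPart_apply]
  fin_cases i <;> fin_cases j <;>
    simp [planarGrad, radialGrad, planarStrain, shearDiff, shearProd, e] <;> ring

/-- Each squared norm is one eighth of the work of a load on the field it causes. The two works
compare pointwise: both integrands are multiples of `g (x φ_x + y φ_y)`, with factors 2 and 1. -/
theorem IsProfile.innerL2_turnedStrain_self (h : IsProfile φ k g C) :
    innerL2 (turnedStrain k g) (turnedStrain k g) =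
      2 * innerL2 (planarStrain φ k g) (planarStrain φ k g) := by
  have h1 := h.isWeakGradient_turnedField.turnedLoad_eq_innerL2 h
  have h2 := h.isWeakGradient_planarField.planarLoad_eq_innerL2 h
  rw [symPart_turnedGrad] at h1
  rw [innerL2_congr_right h.symPart_planarGrad] at h2
  have h3 : turnedLoad φ (turnedField g) = 2 * planarLoad φ (planarField g) := by
    rw [turnedLoad, planarLoad, ← integral_const_mul]
    congr 1
    ext x
    simp [turnedField, planarField]
    ring
  linarith

/-- Norm zero makes `shearDiff` vanish almost everywhere, hence by continuity everywhere off the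
axis. On the half-plane `y = 0`, `x > 0` it is 16 times the defect, which is nonzero somewhere. -/
theorem IsProfile.innerL2_turnedStrain_pos (h : IsProfile φ k g C) :
    0 < innerL2 (turnedStrain k g) (turnedStrain k g) := by
  refine lt_of_le_of_ne (innerL2_self_nonneg _) fun h0 => ?_
  have hz := h.memL2_turnedStrain.ae_eq_zero h0.symm
  have hd : shearDiff k g =ᵐ[volume.restrict puncturedCylinder] fun _ => 0 := by
    rw [← restrict_cylinder_eq]
    filter_upwards [hz] with x hx
    have := congrFun (congrFun hx 0) 1
    simpa [turnedStrain] using this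
  have he := Measure.eqOn_open_of_ae_eq hd isOpen_puncturedCylinder
    h.contDiffOn_shearDiff.continuousOn continuousOn_const
  obtain ⟨s, hs, hne⟩ := h.defect_ne
  have hsq := Real.sq_sqrt hs.1.le
  have hax : axisSq ![Real.sqrt s, 0, 1 / 2] = s := by simp [axisSq, hsq]
  have hx : (![Real.sqrt s, 0, 1 / 2] : V3) ∈ puncturedCylinder := by
    refine ⟨⟨?_, ?_, ?_⟩, ?_⟩
    · simpa [hsq] using hs.2
    · simp
    · simpa using by norm_num
    · rw [hax]; exact hs.1
  have := he hx
  simp only [shearDiff, hax, shearFactor] at this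
  simp [hsq] at this
  exact this.elim hne hs.1.ne'

end Strains

/-! ### The minimizers -/

section Minimizers

variable {W : M3 → ℝ≥0∞} {φ : ℝ × ℝ → ℝ} {k g : ℝ → ℝ} {C : ℝ} {ψ : ℝ → ℝ} {u : V3 → V3}
  {A : V3 → M3}

theorem IsWeakGradient.limitEnergy_eq (hu : IsWeakGradient cylinder u A)
    (hW : IsAdmissibleDensity W) (h : IsProfile φ k g C) (hψ : ContinuousOn ψ (Icc 0 1))
    (hψ0 : ∫ z in (0 : ℝ)..1, ψ z = 0) (hψ1 : 0 < ∫ z in (0 : ℝ)..1, z * ψ z) :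
    limitEnergy cylinder W (force φ ψ) u = 4 * innerL2 (symPart A) (symPart A) -
      Real.sqrt (planarLoad φ u ^ 2 + turnedLoad φ u ^ 2) - axialLoad ψ u := by
  have h1 : ∫ x in cylinder, quadForm W (strain cylinder u x) =
      4 * innerL2 (symPart A) (symPart A) := by
    rw [innerL2, ← integral_const_mul]
    refine integral_congr_ae ?_
    filter_upwards [hu.strain_ae_eq isOpen_cylinder] with x hx
    rw [hW.quadForm_eq_sum (isSymm_strain _ _ _), hx]
  rw [limitEnergy, h1, load_eq h hψ hu.memLp, sSup_load_eq h hψ hψ0 hψ1 hu.memLp]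
  ring

/-- The energy as a sum of squares. -/
theorem IsWeakGradient.exists_limitEnergy_eq (hu : IsWeakGradient cylinder u A)
    (hW : IsAdmissibleDensity W) (h : IsProfile φ k g C) (hψ : ContinuousOn ψ (Icc 0 1))
    (hψ0 : ∫ z in (0 : ℝ)..1, ψ z = 0) (hψ1 : 0 < ∫ z in (0 : ℝ)..1, z * ψ z) :
    ∃ c s : ℝ, c ^ 2 + s ^ 2 = 1 ∧
      limitEnergy cylinder W (force φ ψ) u =
        4 * innerL2 (symPart A + ((-c) • planarStrain φ k g + (s • turnedStrain k g +
            (-1 : ℝ) • axialStrain ψ)))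
          (symPart A + ((-c) • planarStrain φ k g + (s • turnedStrain k g +
            (-1 : ℝ) • axialStrain ψ))) +
        2 * c ^ 2 * innerL2 (turnedStrain k g) (turnedStrain k g) -
        4 * (innerL2 (turnedStrain k g) (turnedStrain k g) +
          innerL2 (axialStrain ψ) (axialStrain ψ)) := by
  -- With `c, s` optimal for `u`, the load terms equal 8 times the product of `𝔼(u)` with `c planar
  -- - s turned + axial`. Completing the square subtracts `4(c²‖planar‖² + s²‖turned‖² + ‖axial‖²)`;
  -- then `‖turned‖² = 2‖planar‖²` and `s² = 1 - c²` give the stated form.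
  obtain ⟨c, s, hcs, he⟩ := exists_mul_sub_mul_eq_sqrt (planarLoad φ u) (turnedLoad φ u)
  refine ⟨c, s, hcs, ?_⟩
  rw [hu.limitEnergy_eq hW h hψ hψ0 hψ1, ← he, hu.planarLoad_eq_innerL2 h,
    hu.turnedLoad_eq_innerL2 h, hu.axialLoad_eq_innerL2 hψ hψ0]
  have mS := hu.memL2.symPart
  have mP := h.memL2_planarStrain
  have mT := h.memL2_turnedStrain
  have mX := memL2_axialStrain hψ
  have m1 := (mT.const_smul s).add (mX.const_smul (-1))
  have m2 := (mP.const_smul (-c)).add m1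
  rw [innerL2_add_left mS m2 (mS.add m2), innerL2_add_right mS m2 mS, innerL2_add_right mS m2 m2,
    innerL2_comm _ (symPart A)]
  simp only [innerL2_add_left (mP.const_smul (-c)) m1 mS,
    innerL2_add_left (mP.const_smul (-c)) m1 m2,
    innerL2_add_left (mT.const_smul s) (mX.const_smul (-1)) mS,
    innerL2_add_left (mT.const_smul s) (mX.const_smul (-1)) m2,
    innerL2_smul_left, innerL2_smul_right,
    innerL2_add_right (mP.const_smul (-c)) m1 mS, innerL2_add_right (mP.const_smul (-c)) m1 mP,
    innerL2_add_right (mP.const_smul (-c)) m1 mT, innerL2_add_right (mP.const_smul (-c)) m1 mX,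
    innerL2_add_right (mT.const_smul s) (mX.const_smul (-1)) mS,
    innerL2_add_right (mT.const_smul s) (mX.const_smul (-1)) mP,
    innerL2_add_right (mT.const_smul s) (mX.const_smul (-1)) mT,
    innerL2_add_right (mT.const_smul s) (mX.const_smul (-1)) mX]
  rw [innerL2_comm (turnedStrain k g) (planarStrain φ k g),
    innerL2_comm (axialStrain ψ) (planarStrain φ k g),
    innerL2_comm (axialStrain ψ) (turnedStrain k g), innerL2_planar_turned, innerL2_planar_axial,
    innerL2_turned_axial, innerL2_comm (symPart A) (planarStrain φ k g),
    innerL2_comm (symPart A) (turnedStrain k g), innerL2_comm (symPart A) (axialStrain ψ),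
    h.innerL2_turnedStrain_self]
  have hs : s ^ 2 = 1 - c ^ 2 := by linarith
  linear_combination (-8 * innerL2 (planarStrain φ k g) (planarStrain φ k g)) * hs

/-- The two minimizers, for `σ = 1` and `σ = -1`. -/
def optimalField (g ψ : ℝ → ℝ) (σ : ℝ) : V3 → V3 := σ • turnedField g + axialField ψ

theorem IsProfile.isWeakGradient_optimalField (h : IsProfile φ k g C)
    (hψ : ContinuousOn ψ (Icc 0 1)) (σ : ℝ) :
    IsWeakGradient cylinder (optimalField g ψ σ) (σ • turnedGrad k g + axialGrad ψ) :=
  (h.isWeakGradient_turnedField.const_smul σ).add (isWeakGradient_axialField hψ)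

theorem symPart_add (A B : V3 → M3) : symPart (A + B) = symPart A + symPart B := by
  ext x i j
  simp [symPart]
  ring

theorem symPart_smul (c : ℝ) (A : V3 → M3) : symPart (c • A) = c • symPart A := by
  ext x i j
  simp [symPart]
  ring

theorem symPart_optimal (σ : ℝ) : symPart (σ • turnedGrad k g + axialGrad ψ) =
    σ • turnedStrain k g + axialStrain ψ := by
  rw [symPart_add, symPart_smul, symPart_turnedGrad, symPart_axialGrad]

theorem limitEnergy_optimalField (hW : IsAdmissibleDensity W) (h : IsProfile φ k g C)
    (hψ : ContinuousOn ψ (Icc 0 1)) (hψ0 : ∫ z in (0 : ℝ)..1, ψ z = 0)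
    (hψ1 : 0 < ∫ z in (0 : ℝ)..1, z * ψ z) {σ : ℝ} (hσ : σ ^ 2 = 1) :
    limitEnergy cylinder W (force φ ψ) (optimalField g ψ σ) =
      -4 * (innerL2 (turnedStrain k g) (turnedStrain k g) +
        innerL2 (axialStrain ψ) (axialStrain ψ)) := by
  have hu := h.isWeakGradient_optimalField hψ σ
  have mP := h.memL2_planarStrain
  have mT := h.memL2_turnedStrain
  have mX := memL2_axialStrain hψ
  have mS := (mT.const_smul σ).add mX
  rw [hu.limitEnergy_eq hW h hψ hψ0 hψ1, hu.planarLoad_eq_innerL2 h, hu.turnedLoad_eq_innerL2 h,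
    hu.axialLoad_eq_innerL2 hψ hψ0, symPart_optimal]
  simp only [innerL2_add_left (mT.const_smul σ) mX mS, innerL2_add_right (mT.const_smul σ) mX mP,
    innerL2_add_right (mT.const_smul σ) mX mT, innerL2_add_right (mT.const_smul σ) mX mX,
    innerL2_smul_left, innerL2_smul_right]
  rw [innerL2_comm (axialStrain ψ) (turnedStrain k g), innerL2_planar_turned, innerL2_planar_axial,
    innerL2_turned_axial]
  set β := innerL2 (turnedStrain k g) (turnedStrain k g)
  have hβ : 0 ≤ β := innerL2_self_nonneg _
  -- By orthogonality the planar load is `0` and the turned load is `8σβ`, so the root is `8β` for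
  -- either sign.
  have e : (8 * (σ * 0 + 0)) ^ 2 + (8 * (σ * β + 0)) ^ 2 = (8 * β) ^ 2 := by
    linear_combination 64 * β ^ 2 * hσ
  rw [e, Real.sqrt_sq (by linarith)]
  linear_combination 4 * β * hσ

theorem isMinimizer_optimalField (hW : IsAdmissibleDensity W) (h : IsProfile φ k g C)
    (hψ : ContinuousOn ψ (Icc 0 1)) (hψ0 : ∫ z in (0 : ℝ)..1, ψ z = 0)
    (hψ1 : 0 < ∫ z in (0 : ℝ)..1, z * ψ z) {σ : ℝ} (hσ : σ ^ 2 = 1) :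
    IsMinimizer cylinder W (force φ ψ) (optimalField g ψ σ) := by
  refine ⟨(h.isWeakGradient_optimalField hψ σ).memH1, fun v hv => ?_⟩
  obtain ⟨c, s, -, he⟩ := hv.isWeakGradient_weakGrad.exists_limitEnergy_eq hW h hψ hψ0 hψ1
  rw [limitEnergy_optimalField hW h hψ hψ0 hψ1 hσ, he]
  have h1 := mul_nonneg (sq_nonneg c) (innerL2_self_nonneg (turnedStrain k g))
  have h2 := innerL2_self_nonneg (symPart (weakGrad cylinder v) +
    ((-c) • planarStrain φ k g + (s • turnedStrain k g + (-1 : ℝ) • axialStrain ψ)))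
  linarith

/-- Comparison with the field `σ = 1` forces both nonnegative terms of the sum of squares to vanish:
`c = 0` because `turned ≠ 0`, and then the strain is determined. -/
theorem IsMinimizer.exists_strain_eq (hu : IsMinimizer cylinder W (force φ ψ) u)
    (hW : IsAdmissibleDensity W) (h : IsProfile φ k g C)
    (hψ : ContinuousOn ψ (Icc 0 1)) (hψ0 : ∫ z in (0 : ℝ)..1, ψ z = 0)
    (hψ1 : 0 < ∫ z in (0 : ℝ)..1, z * ψ z) :
    ∃ σ : ℝ, symPart (weakGrad cylinder u) =ᵐ[volume.restrict cylinder]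
      σ • turnedStrain k g + axialStrain ψ := by
  have hG := hu.1.isWeakGradient_weakGrad
  obtain ⟨c, s, -, he⟩ := hG.exists_limitEnergy_eq hW h hψ hψ0 hψ1
  have hle := hu.2 _ (h.isWeakGradient_optimalField hψ 1).memH1
  rw [limitEnergy_optimalField hW h hψ hψ0 hψ1 (one_pow 2), he] at hle
  set D := symPart (weakGrad cylinder u) +
    ((-c) • planarStrain φ k g + (s • turnedStrain k g + (-1 : ℝ) • axialStrain ψ)) with hD
  have hβ := h.innerL2_turnedStrain_pos
  have h1 := mul_nonneg (sq_nonneg c) hβ.le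
  have h2 := innerL2_self_nonneg D
  have hc : c = 0 := by
    have : c ^ 2 * innerL2 (turnedStrain k g) (turnedStrain k g) = 0 := by linarith
    exact pow_eq_zero_iff (two_ne_zero) |>.1 ((mul_eq_zero.1 this).resolve_right hβ.ne')
  have hmD : MemL2 D := hG.memL2.symPart.add ((h.memL2_planarStrain.const_smul _).add
    ((h.memL2_turnedStrain.const_smul _).add ((memL2_axialStrain hψ).const_smul _)))
  refine ⟨-s, ?_⟩
  filter_upwards [hmD.ae_eq_zero (by linarith)] with x hx
  rw [hD, hc] at hx
  ext i j
  have := congrFun (congrFun hx i) j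
  simp at this ⊢
  linarith

end Minimizers

end CylinderGap

end

/-! ### Form of the minimizers and non-uniqueness -/

theorem proposition5p2
    (W : CylinderGap.M3 → ENNReal) (hW : CylinderGap.IsAdmissibleDensity W)
    (φ : ℝ × ℝ → ℝ) (ρ : ℝ → ℝ) (hφ : CylinderGap.IsAdmissiblePotential φ ρ)
    (ψ : ℝ → ℝ) (hψ : ContinuousOn ψ (Set.Icc 0 1))
    (hψ0 : ∫ z in (0 : ℝ)..1, ψ z = 0)
    (hψ1 : 0 < ∫ z in (0 : ℝ)..1, z * ψ z) :
    (∀ u : CylinderGap.V3 → CylinderGap.V3,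
      CylinderGap.IsMinimizer CylinderGap.cylinder W (CylinderGap.force φ ψ) u →
      ∃ w₀ w : CylinderGap.V3 → CylinderGap.V3,
        CylinderGap.IsInfinitesimalRigid CylinderGap.cylinder w₀ ∧
        CylinderGap.MemH1 CylinderGap.cylinder w ∧
        (∀ᵐ x ∂MeasureTheory.volume.restrict CylinderGap.cylinder, u x = w₀ x + w x) ∧
        ∃ (w₁ w₂ : ℝ × ℝ → ℝ) (w₃ : ℝ → ℝ),
          ∀ x ∈ CylinderGap.cylinder, w x = ![w₁ (x 0, x 1), w₂ (x 0, x 1), w₃ (x 2)]) ∧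
    (∃ u v : CylinderGap.V3 → CylinderGap.V3,
      CylinderGap.IsMinimizer CylinderGap.cylinder W (CylinderGap.force φ ψ) u ∧
      CylinderGap.IsMinimizer CylinderGap.cylinder W (CylinderGap.force φ ψ) v ∧
      ¬ CylinderGap.IsInfinitesimalRigid CylinderGap.cylinder (u - v)) := by
  open CylinderGap in
  obtain ⟨C, h⟩ := hφ.exists_isProfile
  set k := sqProfile φ
  set g := profileMean φ
  refine ⟨fun u hu => ?_, ?_⟩
  · obtain ⟨σ, hσ⟩ := hu.exists_strain_eq hW h hψ hψ0 hψ1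
    have hw := h.isWeakGradient_optimalField hψ σ
    have hd := hu.1.isWeakGradient_weakGrad.sub hw
    refine ⟨u - optimalField g ψ σ, optimalField g ψ σ, ⟨hd.memH1, ?_⟩, hw.memH1,
      Filter.Eventually.of_forall fun x => by simp, ?_⟩
    · filter_upwards [hd.strain_ae_eq isOpen_cylinder, hσ] with x h1 h2
      rw [h1, sub_eq_add_neg, ← neg_one_smul ℝ, symPart_add, symPart_smul, symPart_optimal,
        Pi.add_apply, h2]
      simp only [Pi.add_apply, Pi.smul_apply]
      module
    · refine ⟨fun p => σ * (-2 * (g (p.1 ^ 2 + p.2 ^ 2) * p.2)),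
        fun p => σ * (2 * (g (p.1 ^ 2 + p.2 ^ 2) * p.1)),
        fun z => -1 / 8 * axialPrimitive (axialPrimitive ψ) z, fun x _ => ?_⟩
      ext i
      fin_cases i <;> simp [optimalField, turnedField, axialField, axisSq]
  · refine ⟨optimalField g ψ 1, optimalField g ψ (-1),
      isMinimizer_optimalField hW h hψ hψ0 hψ1 (by norm_num),
      isMinimizer_optimalField hW h hψ hψ0 hψ1 (by norm_num), fun hr => ?_⟩
    -- The axial parts cancel and the difference has strain `2 • turnedStrain`, so rigidity would
    -- contradict the positivity of its norm.
    have hd := (h.isWeakGradient_optimalField hψ 1).sub (h.isWeakGradient_optimalField hψ (-1))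
    have hz : turnedStrain k g =ᵐ[MeasureTheory.volume.restrict cylinder] 0 := by
      filter_upwards [hr.2, hd.strain_ae_eq isOpen_cylinder] with x h1 h2
      rw [h1, sub_eq_add_neg, ← neg_one_smul ℝ, symPart_add, symPart_smul, symPart_optimal,
        symPart_optimal] at h2
      ext i j
      have := congrFun (congrFun h2 i) j
      simp at this ⊢
      linarith
    have hpos := h.innerL2_turnedStrain_pos
    rw [innerL2_congr hz hz] at hpos
    simp [innerL2] at hpos
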